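/- Let $H\in(\tfrac12,1)$, $\nu\in(0,1)$, $T>0$ and $R_1<R_2$. On a probability space $(\Omega,\mathcal F,P)$ let $X=\{X(\phi):\phi\in\mathcal D(\mathbb R^2)\}$ be a centered Gaussian family indexed by the smooth compactly supported functions on $\mathbb R^2$, with covariance $$E\big(X(\phi)X(\psi)\big)=H(2H-1)\int_{[0,T]^2}du\,dv\,|u-v|^{2H-2}\int_{\mathbb R^2}dx\,dy\,|x-y|^{-\nu}\phi(u,x)\psi(v,y).$$ Let $\mathcal R(u,x)=\big(\tfrac{u-x}{\sqrt2},\tfrac{u+x}{\sqrt2}\big)$ be the rotation of the plane by $45^\circ$, let $$D_T=\{(s,t)\in\mathcal R([R_1,R_2]^2):\ -s\le t\le -s+\sqrt2\,T\},$$ and for $\varphi\in\mathcal D(D_T)$ (a test function supported in $D_T$) set $\tilde X(\varphi)=X(\varphi\circ\mathcal R)$. For $(s,t)\in D_T$ define $$x(s,t)=\tilde X\big(\mathbf 1_{([0,s]\times[0,t])\cap D_T}\big),$$ where $[0,a]$ means $[a,0]$ if $a<0$, and where $\tilde X(\mathbf 1_A)$, $A\subseteq D_T$, denotes the limit in $L^2(\Omega)$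 of $\tilde X(\varphi_n)$ for any uniformly bounded sequence $(\varphi_n)$ in $\mathcal D(D_T)$ that converges to $\mathbf 1_A$ almost everywhere. For $\eta,\hat\eta\in(0,1)$ let $\mathcal C^{\eta,\hat\eta}(D_T)$ be the space of continuous functions $f$ on $D_T$ such that $$\sup\frac{|f(s_2,t_2)-f(s_2,t_1)-f(s_1,t_2)+f(s_1,t_1)|}{|s_2-s_1|^{\eta}\,|t_2-t_1|^{\hat\eta}}<\infty,$$ the supremum being over all $s_1<s_2$ and $t_1<t_2$ with $[s_1,s_2]\times[t_1,t_2]\subseteq D_T$. Then $x(s,t)$ is well defined for every $(s,t)\in D_T$ (the approximating sequences exist, and the limit exists and does not depend on the sequence, up to almost sure equality), and the process $x$ has a modification $y=\{y(s,t):(s,t)\in D_T\}$ such that, almost surely, the path of $y$ belongs to $\mathcal C^{\eta,\hat\eta}(D_T)$ for all $\eta\in(0,\gamma)$ and $\hat\eta\in(0,\hat\gamma)$ and all $\gamma,\hat\gamma\in(\tfrac12,1)$ with $\gamma+\hat\gamma=H+\frac{2-\nu}{2}$. -/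

import Mathlib

open MeasureTheory ProbabilityTheory Filter Topology Set
open scoped ENNReal

noncomputable section

namespace FracNoise

/-- The space `𝓓(ℝ²)` of real-valued smooth compactly supported functions on the plane. -/
abbrev PlaneTest : Type := TestFunction (⊤ : TopologicalSpace.Opens (ℝ × ℝ)) ℝ ⊤

/-- The rotation of the plane by 45 degrees,
`(u, x) ↦ ((u - x) / √2, (u + x) / √2)`. Its inverse sends `(s, t)` to
`((s + t) / √2, (t - s) / √2)`. -/
def rot45 : (ℝ × ℝ) ≃L[ℝ] (ℝ × ℝ) where
  toFun p := ((p.1 - p.2) / √2, (p.1 + p.2) / √2)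
  invFun p := ((p.1 + p.2) / √2, (p.2 - p.1) / √2)
  map_add' p q := by ext <;> simp <;> ring
  map_smul' c p := by ext <;> simp <;> ring
  left_inv p := by
    have h : √2 * √2 = (2 : ℝ) := Real.mul_self_sqrt (by norm_num)
    ext <;> simp only [← add_div, ← sub_div, div_div, h] <;> ring
  right_inv p := by
    have h : √2 * √2 = (2 : ℝ) := Real.mul_self_sqrt (by norm_num)
    ext <;> simp only [← add_div, ← sub_div, div_div, h] <;> ring
  continuous_toFun := by fun_prop
  continuous_invFun := by fun_prop

/-- The test function `φ ∘ rot45`. -/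
def compRot (φ : PlaneTest) : PlaneTest where
  toFun := fun p => φ (rot45 p)
  contDiff' := φ.contDiff.comp rot45.contDiff
  hasCompactSupport' := φ.hasCompactSupport.comp_homeomorph rot45.toHomeomorph
  tsupport_subset' := fun _ _ => trivial

/-- The covariance functional of the noise: fractional in time (with Hurst index `H`, on the time
interval `[0, T]`), with the Riesz kernel `|x|^{-ν}` in space. -/
def noiseCov (H ν T : ℝ) (φ ψ : ℝ × ℝ → ℝ) : ℝ :=
  H * (2 * H - 1) *
    ∫ w in Icc (0 : ℝ) T ×ˢ Icc (0 : ℝ) T, |w.1 - w.2| ^ (2 * H - 2) *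
      ∫ z : ℝ × ℝ, |z.1 - z.2| ^ (-ν) * (φ (w.1, z.1) * ψ (w.2, z.2))

/-- `X` is a centered Gaussian family indexed by `𝓓(ℝ²)` with covariance `noiseCov H ν T`. -/
structure IsFractionalNoise {Ω : Type*} [MeasurableSpace Ω] (P : Measure Ω) (H ν T : ℝ)
    (X : PlaneTest → Ω → ℝ) : Prop where
  gaussian : IsGaussianProcess X P
  centered : ∀ φ, ∫ ω, X φ ω ∂P = 0
  covariance : ∀ φ ψ, ∫ ω, X φ ω * X ψ ω ∂P = noiseCov H ν T φ ψ

/-- The rotated noise `X̃(φ) = X(φ ∘ rot45)`. -/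
def rotatedNoise {Ω : Type*} (X : PlaneTest → Ω → ℝ) (φ : PlaneTest) : Ω → ℝ :=
  X (compRot φ)

/-- The domain `D_T`: the points `(s, t)` of the rotated square `rot45([R₁, R₂]²)` with
`-s ≤ t ≤ -s + √2 T`. -/
def domain (R₁ R₂ T : ℝ) : Set (ℝ × ℝ) :=
  {p | p ∈ rot45 '' (Icc R₁ R₂ ×ˢ Icc R₁ R₂) ∧ -p.1 ≤ p.2 ∧ p.2 ≤ -p.1 + √2 * T}

/-- `(φ n)` is a uniformly bounded sequence of test functions supported in `D` that converges
almost everywhere to the indicator function of `A`. -/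
structure IsApproximating (D A : Set (ℝ × ℝ)) (φ : ℕ → PlaneTest) : Prop where
  support : ∀ n, tsupport (φ n) ⊆ D
  bounded : ∃ M : ℝ, ∀ n p, |φ n p| ≤ M
  tendsto : ∀ᵐ p ∂(volume : Measure (ℝ × ℝ)),
    Tendsto (fun n => φ n p) atTop (𝓝 (A.indicator (fun _ => (1 : ℝ)) p))

/-- The random variable `ξ` is (a version of) `X̃(1_A)`, for `A ⊆ D`: it is the limit in `L²(Ω)` of
`X̃(φ n)`, for one and for every sequence `(φ n)` in `𝓓(D)` approximating `1_A`. -/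
structure IsRotatedNoiseOfSet {Ω : Type*} [MeasurableSpace Ω] (P : Measure Ω)
    (X : PlaneTest → Ω → ℝ) (D A : Set (ℝ × ℝ)) (ξ : Ω → ℝ) : Prop where
  memLp : MemLp ξ 2 P
  exists_approx : ∃ φ, IsApproximating D A φ
  tendsto : ∀ φ, IsApproximating D A φ →
    Tendsto (fun n => eLpNorm (rotatedNoise X (φ n) - ξ) 2 P) atTop (𝓝 0)

/-- The set `([0, s] × [0, t]) ∩ D`, where `[0, a]` is read as `[a, 0]` if `a` is negative. -/
def cornerRect (D : Set (ℝ × ℝ)) (p : ℝ × ℝ) : Set (ℝ × ℝ) :=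
  (uIcc 0 p.1 ×ˢ uIcc 0 p.2) ∩ D

/-- The increment of `f` on the rectangle `[s₁, s₂] × [t₁, t₂]`. -/
def rectIncr (f : ℝ × ℝ → ℝ) (s₁ s₂ t₁ t₂ : ℝ) : ℝ :=
  f (s₂, t₂) - f (s₂, t₁) - f (s₁, t₂) + f (s₁, t₁)

/-- The Hölder seminorm on rectangles contained in `D`. -/
def rectHolderNorm (D : Set (ℝ × ℝ)) (η η' : ℝ) (f : ℝ × ℝ → ℝ) : ℝ≥0∞ :=
  ⨆ (s₁ : ℝ) (s₂ : ℝ) (t₁ : ℝ) (t₂ : ℝ) (_ : s₁ < s₂) (_ : t₁ < t₂)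
    (_ : Icc s₁ s₂ ×ˢ Icc t₁ t₂ ⊆ D),
    ENNReal.ofReal (|rectIncr f s₁ s₂ t₁ t₂| / (|s₂ - s₁| ^ η * |t₂ - t₁| ^ η'))

/-- The space `C^{η,η'}(D)` of continuous functions on `D` with finite Hölder seminorm on
rectangles. -/
def MemRectHolder (D : Set (ℝ × ℝ)) (η η' : ℝ) (f : ℝ × ℝ → ℝ) : Prop :=
  ContinuousOn f D ∧ rectHolderNorm D η η' f < ⊤

end FracNoise

end

noncomputable section

namespace FracNoise

/-! ### One-dimensional singular integrals -/

/-! In rotated coordinates the covariance of the noise is a double integral against a constant times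
the kernel |a+b|^{-α} |a-b|^{-ν}, where α = 2 - 2H and (a, b) is the difference of the two points.
The analytic core is a scaling bound: over a rectangle with sides l and m the kernel integrates to
at most C l^{1-p} m^{1-q}, uniformly in the position, for all p, q in (0,1) with p + q = α + ν
(`exists_lintegral_rotKernel_le`). The larger of |a+b| and |a-b| is at least |a|, so its singularity
can be shared between the two directions. With p = 2 - 2γ and q = 2 - 2γ', integrating once more
gives the square of the rectangle mass at most C l^{2γ} m^{2γ'} (`exists_noiseMeasure_rect_le`).

The covariance is thus integration against a finite measure on pairs of points that is absolutely
continuous with respect to Lebesgue measure. Dominated convergence makes the noise Cauchy in L²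
along any bounded sequence of test functions converging almost everywhere, so the integral of an
indicator exists and does not depend on the sequence (`exists_tendsto_eLpNorm`,
`ae_eq_of_isWienerIntegral`). Fatou's lemma carries the Gaussian moment bounds to these limits
(`lintegral_enorm_pow_le`), so the limits need not be shown to be Gaussian.

For regularity, x(s,t) is replaced by W(s,t) = sign(s) sign(t) x(s,t), extended to the whole plane.
Rectangular increments of W are then integrals of indicators of rectangles cut with the domain, and
W vanishes on the axes. A two-parameter Kolmogorov argument controls all dyadic cells at once
(`ae_exists_dyadicCellBound`), and one-dimensional chaining in each variable extends this to dyadic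
rectangles (`DyadicCellBound.rectHolderOn`). Limits along dyadic points give a continuous field,
equal to W almost surely at each point by L² continuity (`ae_dyadicLim_eq`). Multiplying the signs
back costs only a constant because the field vanishes on the axes (`RectHolderOn.signTwist`).
Rational exponents reduce all admissible parameters to one null set. -/

lemma lintegral_Ioc_enorm_rpow_neg {q r : ℝ} (hq : q < 1) (hr : 0 ≤ r) :
    ∫⁻ x in Ioc 0 r, ‖x‖ₑ ^ (-q) = ENNReal.ofReal (r ^ (1 - q) / (1 - q)) := by
  have h1 : ∫⁻ x in Ioc 0 r, ‖x‖ₑ ^ (-q) = ∫⁻ x in Ioc 0 r, ENNReal.ofReal (x ^ (-q)) := by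
    refine setLIntegral_congr_fun measurableSet_Ioc fun x hx => ?_
    rw [Real.enorm_eq_ofReal hx.1.le, ENNReal.ofReal_rpow_of_pos hx.1]
  have hinteg : IntervalIntegrable (fun x : ℝ => x ^ (-q)) volume 0 r :=
    intervalIntegral.intervalIntegrable_rpow' (by linarith)
  rw [h1, ← ofReal_integral_eq_lintegral_ofReal
    ((intervalIntegrable_iff_integrableOn_Ioc_of_le hr).1 hinteg),
    ← intervalIntegral.integral_of_le hr, integral_rpow (Or.inl (by linarith)),
    Real.zero_rpow (by linarith)]
  · congr 2 <;> ring_nf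
  · exact (ae_restrict_iff' measurableSet_Ioc).2
      (Eventually.of_forall fun x hx => Real.rpow_nonneg hx.1.le _)

lemma lintegral_Icc_enorm_rpow_neg_le {q r : ℝ} (hq : q < 1) (hr : 0 ≤ r) :
    ∫⁻ x in Icc (-r) r, ‖x‖ₑ ^ (-q) ≤ ENNReal.ofReal (2 * (r ^ (1 - q) / (1 - q))) := by
  have hsub : Icc (-r) r ⊆ Icc (-r) 0 ∪ Icc 0 r := fun x hx => by
    rcases le_total x 0 with h | h
    · exact Or.inl ⟨hx.1, h⟩
    · exact Or.inr ⟨h, hx.2⟩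
  have hpos : ∫⁻ x in Icc 0 r, ‖x‖ₑ ^ (-q) = ENNReal.ofReal (r ^ (1 - q) / (1 - q)) := by
    rw [← lintegral_Ioc_enorm_rpow_neg hq hr]
    exact setLIntegral_congr Ioc_ae_eq_Icc.symm
  have hneg : ∫⁻ x in Icc (-r) 0, ‖x‖ₑ ^ (-q) = ∫⁻ x in Icc 0 r, ‖x‖ₑ ^ (-q) := by
    have h := (Measure.measurePreserving_neg (volume : Measure ℝ)).setLIntegral_comp_preimage
      (s := Icc 0 r) measurableSet_Icc (f := fun x : ℝ => ‖x‖ₑ ^ (-q)) (by fun_prop)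
    rw [← h]
    simp
  calc ∫⁻ x in Icc (-r) r, ‖x‖ₑ ^ (-q)
      ≤ ∫⁻ x in Icc (-r) 0 ∪ Icc 0 r, ‖x‖ₑ ^ (-q) := lintegral_mono_set hsub
    _ ≤ _ := lintegral_union_le _ _ _
    _ = _ := by
      have : 0 ≤ r ^ (1 - q) / (1 - q) :=
        div_nonneg (Real.rpow_nonneg hr _) (by linarith)
      rw [hneg, hpos, ← ENNReal.ofReal_add this this, two_mul]

/-- The constant in the estimate of the integral of `|x - z| ^ (-q)` over an interval. -/
def singConst (q : ℝ) : ℝ := 2 / (1 - q) + 1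

lemma singConst_nonneg {q : ℝ} (hq : q < 1) : 0 ≤ singConst q := by
  have : 0 < 1 - q := by linarith
  unfold singConst; positivity

/-- With r the length of the interval, the part within r of the singularity is integrated exactly,
and the integrand is at most r^{-q} elsewhere. This makes the bound uniform in the position of the
singularity. -/
lemma lintegral_Icc_enorm_sub_rpow_neg_le {q c d : ℝ} (hq0 : 0 ≤ q) (hq : q < 1) (hcd : c ≤ d)
    (z : ℝ) :
    ∫⁻ x in Icc c d, ‖x - z‖ₑ ^ (-q) ≤ ENNReal.ofReal (singConst q * (d - c) ^ (1 - q)) := by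
  rcases hcd.eq_or_lt with rfl | hlt
  · simp
  set r := d - c with hr
  have hr0 : 0 < r := by simp [hr, hlt]
  have hpt : ∀ x, ‖x - z‖ₑ ^ (-q) ≤
      (Icc (z - r) (z + r)).indicator (fun x => ‖x - z‖ₑ ^ (-q)) x + ENNReal.ofReal (r ^ (-q)) := by
    intro x
    by_cases hx : x ∈ Icc (z - r) (z + r)
    · rw [indicator_of_mem hx]; exact le_self_add
    · refine le_add_left ?_
      have hrx : r ≤ |x - z| := by
        by_contra! hc
        rw [abs_lt] at hc
        exact hx ⟨by linarith, by linarith⟩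
      rw [Real.enorm_eq_ofReal_abs, ENNReal.ofReal_rpow_of_pos (hr0.trans_le hrx)]
      exact ENNReal.ofReal_le_ofReal
        (Real.rpow_le_rpow_of_nonpos hr0 hrx (by linarith))
  have hshift : ∫⁻ x in Icc (z - r) (z + r), ‖x - z‖ₑ ^ (-q) = ∫⁻ x in Icc (-r) r, ‖x‖ₑ ^ (-q) := by
    have h := (measurePreserving_sub_right (volume : Measure ℝ) z).setLIntegral_comp_preimage
      (s := Icc (-r) r) measurableSet_Icc (f := fun x : ℝ => ‖x‖ₑ ^ (-q)) (by fun_prop)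
    rw [← h]
    congr 2
    ext x
    simp only [mem_Icc, mem_preimage]
    constructor <;> rintro ⟨h1, h2⟩ <;> constructor <;> linarith
  calc ∫⁻ x in Icc c d, ‖x - z‖ₑ ^ (-q)
      ≤ ∫⁻ x in Icc c d, ((Icc (z - r) (z + r)).indicator (fun x => ‖x - z‖ₑ ^ (-q)) x +
          ENNReal.ofReal (r ^ (-q))) := lintegral_mono hpt
    _ = (∫⁻ x in Icc c d, (Icc (z - r) (z + r)).indicator (fun x => ‖x - z‖ₑ ^ (-q)) x) +
          ENNReal.ofReal (r ^ (-q)) * ENNReal.ofReal r := by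
        rw [lintegral_add_right _ measurable_const]
        simp [hr]
    _ ≤ ENNReal.ofReal (2 * (r ^ (1 - q) / (1 - q))) + ENNReal.ofReal (r ^ (1 - q)) := by
        gcongr
        · refine (setLIntegral_le_lintegral _ _).trans ?_
          rw [lintegral_indicator measurableSet_Icc, hshift]
          exact lintegral_Icc_enorm_rpow_neg_le hq hr0.le
        · rw [← ENNReal.ofReal_mul (by positivity), ← Real.rpow_add_one hr0.ne']
          ring_nf; rfl
    _ = _ := by
        have h1q : 0 < 1 - q := by linarith
        rw [← ENNReal.ofReal_add (by positivity) (by positivity)]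
        congr 1
        unfold singConst; ring

/-! ### The kernel in rotated coordinates -/

/-- The product of the temporal and the spatial kernel, in rotated coordinates. -/
def rotKernel (α ν a b : ℝ) : ℝ := |a + b| ^ (-α) * |a - b| ^ (-ν)

lemma rotKernel_swap (α ν a b : ℝ) : rotKernel α ν b a = rotKernel α ν a b := by
  rw [rotKernel, rotKernel, add_comm b a, abs_sub_comm b a]

lemma measurable_rotKernel (α ν : ℝ) {β : Type*} [MeasurableSpace β] {f g : β → ℝ}
    (hf : Measurable f) (hg : Measurable g) : Measurable fun x => rotKernel α ν (f x) (g x) := by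
  unfold rotKernel
  simp only [← Real.norm_eq_abs]
  fun_prop

/-- Since p + (q - ν) = α, the power of A splits in two. As A dominates both s and Z, one piece is
charged to s and the other to Z. -/
lemma rpow_neg_mul_rpow_neg_le {A Z s α ν p q : ℝ} (hp : 0 ≤ p) (hνq : ν ≤ q)
    (hpq : p + q = α + ν) (hs : 0 < s) (hZ : 0 < Z) (hsA : s ≤ A) (hZA : Z ≤ A) :
    A ^ (-α) * Z ^ (-ν) ≤ s ^ (-p) * Z ^ (-q) := by
  have hA : 0 < A := hs.trans_le hsA
  calc A ^ (-α) * Z ^ (-ν) = A ^ (-p) * A ^ (-(q - ν)) * Z ^ (-ν) := by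
        rw [← Real.rpow_add hA]; congr 2; linarith
    _ ≤ s ^ (-p) * Z ^ (-(q - ν)) * Z ^ (-ν) := by
        have h1 := Real.rpow_le_rpow_of_nonpos hs hsA (neg_nonpos.2 hp)
        have h2 := Real.rpow_le_rpow_of_nonpos hZ hZA (neg_nonpos.2 (sub_nonneg.2 hνq))
        gcongr
    _ = s ^ (-p) * Z ^ (-q) := by
        rw [mul_assoc, ← Real.rpow_add hZ]; congr 2; ring

/-- As |a| ≤ max(|a+b|, |a-b|), the larger factor gives up the exponent p to |a| and the rest to the
smaller factor. Either factor may be the smaller one, hence the sum and the two conditions on q. -/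
lemma ofReal_rotKernel_le {α ν p q : ℝ} (hα : 0 < α) (hν : 0 < ν) (hp : 0 < p) (hαq : α ≤ q)
    (hνq : ν ≤ q) (hpq : p + q = α + ν) (a b : ℝ) :
    ENNReal.ofReal (rotKernel α ν a b) ≤
      ‖a‖ₑ ^ (-p) * (‖a - b‖ₑ ^ (-q) + ‖a + b‖ₑ ^ (-q)) := by
  -- The singular lines are harmless: real powers of zero make the left side vanish on a = ±b, and
  -- on a = 0 the extended power on the right is `⊤`.
  by_cases hA : a + b = 0
  · simp [rotKernel, hA, Real.zero_rpow (neg_ne_zero.2 hα.ne')]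
  by_cases hZ : a - b = 0
  · simp [rotKernel, hZ, Real.zero_rpow (neg_ne_zero.2 hν.ne')]
  by_cases ha : a = 0
  · have h0 : ‖a + b‖ₑ ^ (-q) ≠ 0 := by
      rw [Ne, ENNReal.rpow_eq_zero_iff]
      simp [hA]
    have h1 : ‖a - b‖ₑ ^ (-q) + ‖a + b‖ₑ ^ (-q) ≠ 0 := by
      intro h; exact h0 (add_eq_zero.1 h).2
    have h2 : ‖a‖ₑ ^ (-p) = ⊤ := by simp [ha, ENNReal.zero_rpow_of_neg, hp]
    rw [h2, ENNReal.top_mul h1]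
    exact le_top
  have hA' := abs_pos.2 hA
  have hZ' := abs_pos.2 hZ
  have ha' := abs_pos.2 ha
  have hmax : |a| ≤ max |a + b| |a - b| := by
    rw [le_max_iff]
    by_contra! h
    simp only [abs_lt] at h
    rcases abs_cases a with h' | h' <;> linarith [h.1.1, h.1.2, h.2.1, h.2.2, h'.1]
  simp only [Real.enorm_eq_ofReal_abs]
  rw [ENNReal.ofReal_rpow_of_pos ha', ENNReal.ofReal_rpow_of_pos hA',
    ENNReal.ofReal_rpow_of_pos hZ', ← ENNReal.ofReal_add (by positivity) (by positivity),
    ← ENNReal.ofReal_mul (by positivity)]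
  refine ENNReal.ofReal_le_ofReal ?_
  rw [mul_add, rotKernel]
  rcases le_total |a - b| |a + b| with h | h
  · rw [max_eq_left h] at hmax
    exact (rpow_neg_mul_rpow_neg_le hp.le hνq hpq ha' hZ' hmax h).trans
      (le_add_of_nonneg_right (by positivity))
  · rw [max_eq_right h] at hmax
    rw [mul_comm (|a + b| ^ (-α))]
    exact (rpow_neg_mul_rpow_neg_le hp.le hαq (by linarith) ha' hA' hmax h).trans
      (le_add_of_nonneg_left (by positivity))

lemma lintegral_rotKernel_le_of_le {α ν p q : ℝ} (hα : 0 < α) (hν : 0 < ν) (hp : 0 < p)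
    (hp1 : p < 1) (hq1 : q < 1) (hαq : α ≤ q) (hνq : ν ≤ q) (hpq : p + q = α + ν)
    {c d e f : ℝ} (hcd : c ≤ d) (hef : e ≤ f) (s t : ℝ) :
    ∫⁻ s' in Icc c d, ∫⁻ t' in Icc e f, ENNReal.ofReal (rotKernel α ν (s - s') (t - t')) ≤
      ENNReal.ofReal (2 * singConst p * singConst q * ((d - c) ^ (1 - p) * (f - e) ^ (1 - q))) := by
  have hq0 : 0 ≤ q := hα.le.trans hαq
  have hinner : ∀ s', ∫⁻ t' in Icc e f, ENNReal.ofReal (rotKernel α ν (s - s') (t - t')) ≤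
      ‖s' - s‖ₑ ^ (-p) * ENNReal.ofReal (2 * (singConst q * (f - e) ^ (1 - q))) := by
    intro s'
    have hq' := mul_nonneg (singConst_nonneg hq1) (Real.rpow_nonneg (sub_nonneg.2 hef) (1 - q))
    calc ∫⁻ t' in Icc e f, ENNReal.ofReal (rotKernel α ν (s - s') (t - t'))
        ≤ ∫⁻ t' in Icc e f, ‖s' - s‖ₑ ^ (-p) *
            (‖t' - (t - (s - s'))‖ₑ ^ (-q) + ‖t' - (t + (s - s'))‖ₑ ^ (-q)) := by
          refine lintegral_mono fun t' => ?_
          refine (ofReal_rotKernel_le hα hν hp hαq hνq hpq _ _).trans_eq ?_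
          rw [← enorm_neg (s - s'), ← enorm_neg (s - s' + (t - t'))]
          congr 3 <;> ring_nf
      _ = ‖s' - s‖ₑ ^ (-p) * ((∫⁻ t' in Icc e f, ‖t' - (t - (s - s'))‖ₑ ^ (-q)) +
            ∫⁻ t' in Icc e f, ‖t' - (t + (s - s'))‖ₑ ^ (-q)) := by
          rw [lintegral_const_mul _ (by fun_prop), lintegral_add_left (by fun_prop)]
      _ ≤ ‖s' - s‖ₑ ^ (-p) * ENNReal.ofReal (2 * (singConst q * (f - e) ^ (1 - q))) := by
          rw [two_mul, ENNReal.ofReal_add hq' hq']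
          gcongr <;> exact lintegral_Icc_enorm_sub_rpow_neg_le hq0 hq1 hef _
  calc _ ≤ ∫⁻ s' in Icc c d, ‖s' - s‖ₑ ^ (-p) *
        ENNReal.ofReal (2 * (singConst q * (f - e) ^ (1 - q))) := lintegral_mono hinner
    _ ≤ ENNReal.ofReal (singConst p * (d - c) ^ (1 - p)) *
        ENNReal.ofReal (2 * (singConst q * (f - e) ^ (1 - q))) := by
        rw [lintegral_mul_const _ (by fun_prop)]
        gcongr
        exact lintegral_Icc_enorm_sub_rpow_neg_le hp.le hp1 hcd _
    _ = _ := by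
        rw [← ENNReal.ofReal_mul (mul_nonneg (singConst_nonneg hp1)
          (Real.rpow_nonneg (sub_nonneg.2 hcd) _))]
        congr 1; ring

/-- For l ≤ m the ratio of the two sides is (l/m)^{p-p'} ≤ 1: moving exponent onto the longer side
weakens the bound. -/
lemma rpow_mul_rpow_le_of_le {l m p q p' q' : ℝ} (hl : 0 ≤ l) (hlm : l ≤ m) (hp : p < 1)
    (hpp : p' ≤ p) (hpq : p + q = p' + q') :
    l ^ (1 - p') * m ^ (1 - q') ≤ l ^ (1 - p) * m ^ (1 - q) := by
  rcases hl.eq_or_lt with rfl | hl0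
  · simp [Real.zero_rpow (sub_pos.2 hp).ne', Real.zero_rpow (sub_pos.2 (hpp.trans_lt hp)).ne']
  have hm0 := hl0.trans_le hlm
  have h1 : l ^ (1 - p') = l ^ (1 - p) * l ^ (p - p') := by
    rw [← Real.rpow_add hl0]; congr 1; ring
  have h2 : m ^ (1 - q) = m ^ (p - p') * m ^ (1 - q') := by
    rw [← Real.rpow_add hm0]; congr 1; linarith
  rw [h1, h2, mul_assoc]
  have := Real.rpow_le_rpow hl hlm (sub_nonneg.2 hpp)
  gcongr

lemma exists_lintegral_rotKernel_le_of_short {α ν p q : ℝ} (hα : α ∈ Ioo (0 : ℝ) 1)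
    (hν : ν ∈ Ioo (0 : ℝ) 1) (hp : p ∈ Ioo (0 : ℝ) 1) (hq : q ∈ Ioo (0 : ℝ) 1)
    (hpq : p + q = α + ν) : ∃ C : ℝ, 0 ≤ C ∧ ∀ c d e f : ℝ, c ≤ d → e ≤ f → d - c ≤ f - e →
      ∀ s t, ∫⁻ s' in Icc c d, ∫⁻ t' in Icc e f,
        ENNReal.ofReal (rotKernel α ν (s - s') (t - t')) ≤
          ENNReal.ofReal (C * ((d - c) ^ (1 - p) * (f - e) ^ (1 - q))) := by
  -- Raising q to q' meets the conditions of the pointwise kernel bound. The complementary p' stays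
  -- positive because α + ν exceeds each of q, α and ν.
  set q' := max q (max α ν) with hq'
  set p' := α + ν - q' with hp'
  have hqq : q ≤ q' := le_max_left _ _
  have hq1 : q' < 1 := max_lt hq.2 (max_lt hα.2 hν.2)
  have hp0 : 0 < p' := by
    rw [hp', sub_pos, hq']
    exact max_lt (by linarith [hp.1]) (max_lt (by linarith [hν.1]) (by linarith [hα.1]))
  have hpp : p' ≤ p := by rw [hp']; linarith
  have hp1 : p' < 1 := hpp.trans_lt hp.2
  have hC : 0 ≤ 2 * singConst p' * singConst q' := by
    have := singConst_nonneg hp1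
    have := singConst_nonneg hq1
    positivity
  refine ⟨_, hC, fun c d e f hcd hef hle s t => ?_⟩
  refine (lintegral_rotKernel_le_of_le hα.1 hν.1 hp0 hp1 hq1
    ((le_max_left _ _).trans (le_max_right _ _)) ((le_max_right _ _).trans (le_max_right _ _))
    (by rw [hp']; ring) hcd hef s t).trans (ENNReal.ofReal_le_ofReal ?_)
  exact mul_le_mul_of_nonneg_left (rpow_mul_rpow_le_of_le (sub_nonneg.2 hcd) hle hp.2 hpp
    (by rw [hp', hpq]; ring)) hC

/-- The scaling bound of the kernel on rectangles. -/
lemma exists_lintegral_rotKernel_le {α ν p q : ℝ} (hα : α ∈ Ioo (0 : ℝ) 1)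
    (hν : ν ∈ Ioo (0 : ℝ) 1) (hp : p ∈ Ioo (0 : ℝ) 1) (hq : q ∈ Ioo (0 : ℝ) 1)
    (hpq : p + q = α + ν) : ∃ C : ℝ, 0 ≤ C ∧ ∀ c d e f : ℝ, c ≤ d → e ≤ f →
      ∀ s t, ∫⁻ s' in Icc c d, ∫⁻ t' in Icc e f,
        ENNReal.ofReal (rotKernel α ν (s - s') (t - t')) ≤
          ENNReal.ofReal (C * ((d - c) ^ (1 - p) * (f - e) ^ (1 - q))) := by
  obtain ⟨C₁, hC₁, h₁⟩ := exists_lintegral_rotKernel_le_of_short hα hν hp hq hpq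
  obtain ⟨C₂, hC₂, h₂⟩ := exists_lintegral_rotKernel_le_of_short hα hν hq hp (by linarith)
  refine ⟨max C₁ C₂, hC₁.trans (le_max_left _ _), fun c d e f hcd hef s t => ?_⟩
  have hnn : 0 ≤ (d - c) ^ (1 - p) * (f - e) ^ (1 - q) :=
    mul_nonneg (Real.rpow_nonneg (sub_nonneg.2 hcd) _) (Real.rpow_nonneg (sub_nonneg.2 hef) _)
  rcases le_total (d - c) (f - e) with h | h
  · refine (h₁ c d e f hcd hef h s t).trans (ENNReal.ofReal_le_ofReal ?_)
    gcongr
    exact le_max_left _ _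
  -- The kernel is symmetric in its two arguments, so the other case is the first one with the sides
  -- exchanged.
  · rw [lintegral_lintegral_swap
      (measurable_rotKernel α ν (by fun_prop) (by fun_prop)).ennreal_ofReal.aemeasurable]
    simp only [fun s' t' => rotKernel_swap α ν (t - t') (s - s')]
    refine (h₂ e f c d hef hcd h t s).trans (ENNReal.ofReal_le_ofReal ?_)
    rw [mul_comm ((f - e) ^ _)]
    gcongr
    exact le_max_right _ _

/-! ### The covariance measure -/

lemma rot45_apply (p : ℝ × ℝ) : rot45 p = ((p.1 - p.2) / √2, (p.1 + p.2) / √2) := rfl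

lemma rot45_symm_apply (p : ℝ × ℝ) :
    rot45.symm p = ((p.1 + p.2) / √2, (p.2 - p.1) / √2) := rfl

lemma det_rot45 : LinearMap.det (rot45 : (ℝ × ℝ) →ₗ[ℝ] ℝ × ℝ) = 1 := by
  have h : √2 * √2 = (2 : ℝ) := Real.mul_self_sqrt (by norm_num)
  rw [← LinearMap.det_toMatrix (Module.Basis.finTwoProd ℝ), Matrix.det_fin_two]
  simp only [LinearMap.toMatrix_apply, Module.Basis.finTwoProd_zero, Module.Basis.finTwoProd_one,
    Module.Basis.coe_finTwoProd_repr]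
  have h1 : (rot45 : (ℝ × ℝ) →ₗ[ℝ] ℝ × ℝ) (1, 0) = (1 / √2, 1 / √2) := by
    change rot45 (1, 0) = _
    simp [rot45_apply]
  have h2 : (rot45 : (ℝ × ℝ) →ₗ[ℝ] ℝ × ℝ) (0, 1) = (-1 / √2, 1 / √2) := by
    change rot45 (0, 1) = _
    simp [rot45_apply]
  rw [h1, h2]
  simp only [Matrix.cons_val_zero, Matrix.cons_val_one]
  field_simp
  norm_num

lemma measurePreserving_rot45 : MeasurePreserving rot45 volume volume := by
  refine ⟨rot45.continuous.measurable, ?_⟩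
  have h := Measure.map_linearMap_addHaar_eq_smul_addHaar (volume : Measure (ℝ × ℝ))
    (f := (rot45 : (ℝ × ℝ) →ₗ[ℝ] ℝ × ℝ)) (by simp [det_rot45])
  rw [det_rot45] at h
  simpa using h

lemma measurePreserving_prodProdProdComm :
    MeasurePreserving (fun z : (ℝ × ℝ) × (ℝ × ℝ) => ((z.1.1, z.2.1), (z.1.2, z.2.2)))
      volume volume := by
  have e1 := measurePreserving_prodAssoc (volume : Measure ℝ) (volume : Measure ℝ)
    (volume : Measure (ℝ × ℝ))
  have e2 := (measurePreserving_prodAssoc (volume : Measure ℝ) (volume : Measure ℝ)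
    (volume : Measure ℝ)).symm
  have e3 := (Measure.measurePreserving_swap (μ := (volume : Measure ℝ))
    (ν := (volume : Measure ℝ))).prod (MeasurePreserving.id (volume : Measure ℝ))
  have e4 := measurePreserving_prodAssoc (volume : Measure ℝ) (volume : Measure ℝ)
    (volume : Measure ℝ)
  have e5 := (MeasurePreserving.id (volume : Measure ℝ)).prod ((e4.comp e3).comp e2)
  have e6 := (measurePreserving_prodAssoc (volume : Measure ℝ) (volume : Measure ℝ)
    (volume : Measure (ℝ × ℝ))).symm
  exact (e6.comp e5).comp e1

/-- The change of variables from (time, time, space, space) to a pair of rotated points. -/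
def rotPair (z : (ℝ × ℝ) × (ℝ × ℝ)) : (ℝ × ℝ) × (ℝ × ℝ) :=
  (rot45 (z.1.1, z.2.1), rot45 (z.1.2, z.2.2))

lemma measurePreserving_rotPair : MeasurePreserving rotPair volume volume :=
  (measurePreserving_rot45.prod measurePreserving_rot45).comp measurePreserving_prodProdProdComm

lemma measurableEmbedding_rotPair : MeasurableEmbedding rotPair := by
  refine measurePreserving_rotPair.measurable.measurableEmbedding ?_
  rintro ⟨⟨a, b⟩, c, d⟩ ⟨⟨a', b'⟩, c', d'⟩ h
  simp only [rotPair, Prod.mk.injEq, EmbeddingLike.apply_eq_iff_eq] at h ⊢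
  tauto

/-- The density of the covariance of the rotated noise. -/
def noiseDensity (H ν : ℝ) (z : (ℝ × ℝ) × (ℝ × ℝ)) : ℝ :=
  H * (2 * H - 1) * (|(rot45.symm z.1).1 - (rot45.symm z.2).1| ^ (2 * H - 2) *
    |(rot45.symm z.1).2 - (rot45.symm z.2).2| ^ (-ν))

lemma noiseDensity_eq (H ν : ℝ) (z : (ℝ × ℝ) × (ℝ × ℝ)) :
    noiseDensity H ν z = H * (2 * H - 1) * (√2 ^ (2 * H - 2) * √2 ^ (-ν))⁻¹ *
      rotKernel (2 - 2 * H) ν (z.1.1 - z.2.1) (z.1.2 - z.2.2) := by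
  have h2 : (0 : ℝ) ≤ √2 := Real.sqrt_nonneg 2
  have h1 : (rot45.symm z.1).1 - (rot45.symm z.2).1 =
      (z.1.1 - z.2.1 + (z.1.2 - z.2.2)) / √2 := by simp only [rot45_symm_apply]; ring
  have h3 : (rot45.symm z.1).2 - (rot45.symm z.2).2 =
      -((z.1.1 - z.2.1 - (z.1.2 - z.2.2)) / √2) := by simp only [rot45_symm_apply]; ring
  rw [noiseDensity, h1, h3, abs_neg, abs_div, abs_div, abs_of_nonneg h2,
    Real.div_rpow (abs_nonneg _) h2, Real.div_rpow (abs_nonneg _) h2, rotKernel, neg_sub,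
    mul_inv]
  ring

lemma noiseDensity_nonneg {H : ℝ} (hH : H ∈ Ioo (1 / 2 : ℝ) 1) (ν : ℝ)
    (z : (ℝ × ℝ) × (ℝ × ℝ)) : 0 ≤ noiseDensity H ν z := by
  have h1 : 0 < H := by linarith [hH.1]
  have h2 : 0 < 2 * H - 1 := by linarith [hH.1]
  unfold noiseDensity; positivity

lemma measurable_noiseDensity (H ν : ℝ) : Measurable (noiseDensity H ν) := by
  have : noiseDensity H ν = fun z => H * (2 * H - 1) * (√2 ^ (2 * H - 2) * √2 ^ (-ν))⁻¹ *
      rotKernel (2 - 2 * H) ν (z.1.1 - z.2.1) (z.1.2 - z.2.2) := funext (noiseDensity_eq H ν)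
  rw [this]
  exact (measurable_rotKernel _ _ (by fun_prop) (by fun_prop)).const_mul _

/-- The measure on pairs of points whose integrals are the covariances of the rotated noise. -/
def noiseMeasure (H ν : ℝ) (D : Set (ℝ × ℝ)) : Measure ((ℝ × ℝ) × (ℝ × ℝ)) :=
  (volume.restrict (D ×ˢ D)).withDensity fun z => ENNReal.ofReal (noiseDensity H ν z)

lemma noiseMeasure_absolutelyContinuous (H ν : ℝ) (D : Set (ℝ × ℝ)) :
    noiseMeasure H ν D ≪ (volume : Measure ((ℝ × ℝ) × (ℝ × ℝ))) :=
  (withDensity_absolutelyContinuous _ _).trans Measure.restrict_le_self.absolutelyContinuous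

/-- With one point fixed, the scaling bound for p = 2 - 2γ and q = 2 - 2γ' applies. Integrating over
that point multiplies by the area, which raises the exponents 1 - p and 1 - q to 2γ and 2γ'. -/
lemma exists_noiseMeasure_rect_le {H ν γ γ' : ℝ} (hH : H ∈ Ioo (1 / 2 : ℝ) 1)
    (hν : ν ∈ Ioo (0 : ℝ) 1) (hγ : γ ∈ Ioo (1 / 2 : ℝ) 1) (hγ' : γ' ∈ Ioo (1 / 2 : ℝ) 1)
    (hsum : γ + γ' = H + (2 - ν) / 2) (D : Set (ℝ × ℝ)) :
    ∃ C : ℝ, 0 ≤ C ∧ ∀ c d e f : ℝ, c ≤ d → e ≤ f →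
      noiseMeasure H ν D ((Icc c d ×ˢ Icc e f) ×ˢ (Icc c d ×ˢ Icc e f)) ≤
        ENNReal.ofReal (C * ((d - c) ^ (2 * γ) * (f - e) ^ (2 * γ'))) := by
  obtain ⟨C, hC, h⟩ := exists_lintegral_rotKernel_le (α := 2 - 2 * H) (ν := ν) (p := 2 - 2 * γ)
    (q := 2 - 2 * γ') ⟨by linarith [hH.2], by linarith [hH.1]⟩ hν
    ⟨by linarith [hγ.2], by linarith [hγ.1]⟩ ⟨by linarith [hγ'.2], by linarith [hγ'.1]⟩
    (by linarith)
  set κ := H * (2 * H - 1) * (√2 ^ (2 * H - 2) * √2 ^ (-ν))⁻¹ with hκ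
  have hκ0 : 0 ≤ κ := by
    have h1 : 0 < H := by linarith [hH.1]
    have h2 : 0 < 2 * H - 1 := by linarith [hH.1]
    rw [hκ]; positivity
  have hmeas := measurable_noiseDensity H ν
  refine ⟨κ * C, mul_nonneg hκ0 hC, fun c d e f hcd hef => ?_⟩
  have hl : 0 ≤ d - c := sub_nonneg.2 hcd
  have hm : 0 ≤ f - e := sub_nonneg.2 hef
  have hin : ∀ x : ℝ × ℝ, ∫⁻ y in Icc c d ×ˢ Icc e f, ENNReal.ofReal (noiseDensity H ν (x, y)) ≤
      ENNReal.ofReal (κ * (C * ((d - c) ^ (1 - (2 - 2 * γ)) * (f - e) ^ (1 - (2 - 2 * γ'))))) := by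
    intro x
    rw [Measure.volume_eq_prod, setLIntegral_prod _ (by fun_prop)]
    simp only [noiseDensity_eq, ← hκ, ENNReal.ofReal_mul hκ0]
    have hm1 := fun s' : ℝ => (measurable_rotKernel (2 - 2 * H) ν
      (f := fun _ : ℝ => x.1 - s') (g := fun t' => x.2 - t') (by fun_prop)
      (by fun_prop)).ennreal_ofReal
    have hm2 := (measurable_rotKernel (2 - 2 * H) ν
      (f := fun z : ℝ × ℝ => x.1 - z.1) (g := fun z => x.2 - z.2) (by fun_prop)
      (by fun_prop)).ennreal_ofReal
    simp only [fun s' => lintegral_const_mul (μ := volume.restrict (Icc e f))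
      (ENNReal.ofReal κ) (hm1 s')]
    rw [lintegral_const_mul _ (Measurable.lintegral_prod_right' hm2)]
    gcongr
    exact h c d e f hcd hef x.1 x.2
  calc noiseMeasure H ν D ((Icc c d ×ˢ Icc e f) ×ˢ (Icc c d ×ˢ Icc e f))
      = ∫⁻ z in (Icc c d ×ˢ Icc e f) ×ˢ (Icc c d ×ˢ Icc e f), ENNReal.ofReal (noiseDensity H ν z)
          ∂(volume.restrict (D ×ˢ D)) := withDensity_apply _ (by measurability)
    _ ≤ ∫⁻ z in (Icc c d ×ˢ Icc e f) ×ˢ (Icc c d ×ˢ Icc e f),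
          ENNReal.ofReal (noiseDensity H ν z) :=
        lintegral_mono' (Measure.restrict_mono_measure Measure.restrict_le_self _) le_rfl
    _ = ∫⁻ x in Icc c d ×ˢ Icc e f, ∫⁻ y in Icc c d ×ˢ Icc e f,
          ENNReal.ofReal (noiseDensity H ν (x, y)) := by
        rw [Measure.volume_eq_prod, setLIntegral_prod _ (by fun_prop)]
    _ ≤ ∫⁻ _ in Icc c d ×ˢ Icc e f, ENNReal.ofReal
          (κ * (C * ((d - c) ^ (1 - (2 - 2 * γ)) * (f - e) ^ (1 - (2 - 2 * γ'))))) :=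
        lintegral_mono hin
    _ = ENNReal.ofReal
          (κ * (C * ((d - c) ^ (1 - (2 - 2 * γ)) * (f - e) ^ (1 - (2 - 2 * γ'))))) *
          (ENNReal.ofReal (d - c) * ENNReal.ofReal (f - e)) := by
        rw [setLIntegral_const, Measure.volume_eq_prod, Measure.prod_prod, Real.volume_Icc,
          Real.volume_Icc]
    _ = _ := by
        rw [← ENNReal.ofReal_mul hl, ← ENNReal.ofReal_mul (by positivity)]
        congr 1
        have h1 : (d - c) ^ (2 * γ) = (d - c) ^ (1 - (2 - 2 * γ)) * (d - c) := by
          rcases hl.eq_or_lt with h0 | h0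
          · rw [← h0, Real.zero_rpow (by linarith [hγ.1]), mul_zero]
          · rw [← Real.rpow_add_one h0.ne']; congr 1; ring
        have h2 : (f - e) ^ (2 * γ') = (f - e) ^ (1 - (2 - 2 * γ')) * (f - e) := by
          rcases hm.eq_or_lt with h0 | h0
          · rw [← h0, Real.zero_rpow (by linarith [hγ'.1]), mul_zero]
          · rw [← Real.rpow_add_one h0.ne']; congr 1; ring
        rw [h1, h2]; ring

lemma isFiniteMeasure_noiseMeasure {H ν : ℝ} (hH : H ∈ Ioo (1 / 2 : ℝ) 1)
    (hν : ν ∈ Ioo (0 : ℝ) 1) {D : Set (ℝ × ℝ)} (hDm : MeasurableSet D)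
    (hD : Bornology.IsBounded D) : IsFiniteMeasure (noiseMeasure H ν D) := by
  obtain ⟨C, -, h⟩ := exists_noiseMeasure_rect_le hH hν
    (γ := (H + (2 - ν) / 2) / 2) (γ' := (H + (2 - ν) / 2) / 2)
    ⟨by linarith [hH.1, hν.2], by linarith [hH.2, hν.1]⟩
    ⟨by linarith [hH.1, hν.2], by linarith [hH.2, hν.1]⟩ (by ring) D
  obtain ⟨M, hM0, hM⟩ := hD.subset_closedBall_lt 0 0
  have hsub : D ⊆ Icc (-M) M ×ˢ Icc (-M) M := by
    intro p hp
    have := hM hp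
    rw [mem_closedBall_zero_iff, Prod.norm_def, max_le_iff, Real.norm_eq_abs, Real.norm_eq_abs,
      abs_le, abs_le] at this
    exact ⟨this.1, this.2⟩
  refine ⟨?_⟩
  have h0 : noiseMeasure H ν D (D ×ˢ D)ᶜ = 0 := by
    rw [noiseMeasure, withDensity_apply _ (hDm.prod hDm).compl]
    simp [Measure.restrict_restrict (hDm.prod hDm).compl]
  calc noiseMeasure H ν D univ ≤ noiseMeasure H ν D (D ×ˢ D) + noiseMeasure H ν D (D ×ˢ D)ᶜ := by
        rw [← union_compl_self (D ×ˢ D)]; exact measure_union_le _ _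
    _ ≤ noiseMeasure H ν D ((Icc (-M) M ×ˢ Icc (-M) M) ×ˢ (Icc (-M) M ×ˢ Icc (-M) M)) := by
        rw [h0, add_zero]; exact measure_mono (prod_mono hsub hsub)
    _ < ⊤ := (h _ _ _ _ (by linarith) (by linarith)).trans_lt ENNReal.ofReal_lt_top

/-! ### The domain and the covariance of the rotated noise -/

lemma domain_eq (R₁ R₂ T : ℝ) :
    domain R₁ R₂ T = rot45 '' ((Icc R₁ R₂ ∩ Icc 0 T) ×ˢ Icc R₁ R₂) := by
  have h2 : 0 < √(2 : ℝ) := by positivity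
  have key : ∀ p : ℝ × ℝ, (-(rot45 p).1 ≤ (rot45 p).2 ∧ (rot45 p).2 ≤ -(rot45 p).1 + √2 * T) ↔
      0 ≤ p.1 ∧ p.1 ≤ T := by
    intro p
    have hh : √2 * √2 = (2 : ℝ) := Real.mul_self_sqrt (by norm_num)
    have hs : (rot45 p).1 + (rot45 p).2 = √2 * p.1 := by
      rw [rot45_apply]; field_simp; linear_combination (-p.1) * hh
    constructor
    · rintro ⟨h, h'⟩
      exact ⟨by nlinarith, by nlinarith⟩
    · rintro ⟨h, h'⟩
      exact ⟨by nlinarith, by nlinarith⟩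
  ext x
  simp only [domain, mem_ofPred_eq, mem_image]
  constructor
  · rintro ⟨⟨p, hp, rfl⟩, h⟩
    exact ⟨p, ⟨⟨hp.1, (key p).1 h⟩, hp.2⟩, rfl⟩
  · rintro ⟨p, ⟨⟨hp1, hp2⟩, hp3⟩, rfl⟩
    exact ⟨⟨p, ⟨hp1, hp3⟩, rfl⟩, (key p).2 hp2⟩

lemma isCompact_domain (R₁ R₂ T : ℝ) : IsCompact (domain R₁ R₂ T) := by
  rw [domain_eq]
  exact ((isCompact_Icc.inter isCompact_Icc).prod isCompact_Icc).image rot45.continuous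

lemma convex_domain (R₁ R₂ T : ℝ) : Convex ℝ (domain R₁ R₂ T) := by
  rw [domain_eq]
  exact (((convex_Icc _ _).inter (convex_Icc _ _)).prod (convex_Icc _ _)).linear_image
    (rot45 : (ℝ × ℝ) →ₗ[ℝ] ℝ × ℝ)

/-- Rotate both points at once by a measure-preserving map. The time window [0,T]² comes for free
from the supports, and finiteness of `noiseMeasure` supplies the integrability that Fubini needs. -/
lemma noiseCov_compRot {H ν T R₁ R₂ : ℝ} (hH : H ∈ Ioo (1 / 2 : ℝ) 1) (hν : ν ∈ Ioo (0 : ℝ) 1)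
    {φ ψ : PlaneTest} (hφ : tsupport φ ⊆ domain R₁ R₂ T) (hψ : tsupport ψ ⊆ domain R₁ R₂ T) :
    noiseCov H ν T (compRot φ) (compRot ψ) =
      ∫ z, φ z.1 * ψ z.2 ∂(noiseMeasure H ν (domain R₁ R₂ T)) := by
  set D := domain R₁ R₂ T with hD
  have hDc : IsCompact D := isCompact_domain R₁ R₂ T
  have hDm : MeasurableSet D := hDc.measurableSet
  have := isFiniteMeasure_noiseMeasure hH hν hDm hDc.isBounded
  have hmeas : Measurable fun z => ENNReal.ofReal (noiseDensity H ν z) :=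
    (measurable_noiseDensity H ν).ennreal_ofReal
  have hzero : ∀ χ : PlaneTest, tsupport χ ⊆ D → ∀ p ∉ D, χ p = 0 := fun χ hχ p hp =>
    image_eq_zero_of_notMem_tsupport fun h => hp (hχ h)
  set F : (ℝ × ℝ) × (ℝ × ℝ) → ℝ := fun z => noiseDensity H ν z * (φ z.1 * ψ z.2) with hF
  have hFzero : ∀ z ∉ D ×ˢ D, F z = 0 := by
    intro z hz
    rw [mem_prod, not_and_or] at hz
    rcases hz with h | h
    · simp [hF, hzero φ hφ _ h]
    · simp [hF, hzero ψ hψ _ h]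
  have hsmul : (fun z : (ℝ × ℝ) × (ℝ × ℝ) =>
      (ENNReal.ofReal (noiseDensity H ν z)).toReal • (φ z.1 * ψ z.2)) = F := by
    funext z
    rw [ENNReal.toReal_ofReal (noiseDensity_nonneg hH ν z), smul_eq_mul]
  have hlt : ∀ᵐ z ∂(volume.restrict (D ×ˢ D)), ENNReal.ofReal (noiseDensity H ν z) < ∞ :=
    Eventually.of_forall fun _ => ENNReal.ofReal_lt_top
  have hinteg : Integrable F := by
    obtain ⟨A, hA⟩ := φ.hasCompactSupport.exists_bound_of_continuous φ.continuous
    obtain ⟨B, hB⟩ := ψ.hasCompactSupport.exists_bound_of_continuous ψ.continuous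
    have h1 : Integrable (fun z : (ℝ × ℝ) × (ℝ × ℝ) => φ z.1 * ψ z.2) (noiseMeasure H ν D) := by
      refine Integrable.of_bound (C := A * B) ?_ (Eventually.of_forall fun z => ?_)
      · exact ((φ.continuous.comp continuous_fst).mul
          (ψ.continuous.comp continuous_snd)).aestronglyMeasurable
      · rw [norm_mul]
        exact mul_le_mul (hA _) (hB _) (norm_nonneg _) ((norm_nonneg _).trans (hA 0))
    rw [noiseMeasure, integrable_withDensity_iff_integrable_smul' hmeas hlt, hsmul] at h1
    exact (integrableOn_iff_integrable_of_support_subset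
      (Function.support_subset_iff'.2 hFzero)).1 h1
  have hR : ∫ z, φ z.1 * ψ z.2 ∂(noiseMeasure H ν D) = ∫ z, F z := by
    rw [noiseMeasure, integral_withDensity_eq_integral_toReal_smul hmeas hlt, hsmul]
    exact setIntegral_eq_integral_of_forall_compl_eq_zero hFzero
  have hcomp : Integrable fun z => F (rotPair z) :=
    (measurePreserving_rotPair.integrable_comp_emb measurableEmbedding_rotPair).2 hinteg
  rw [hR, ← measurePreserving_rotPair.integral_comp measurableEmbedding_rotPair,
    Measure.volume_eq_prod, integral_prod _ hcomp, noiseCov]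
  have hout : ∀ w ∉ Icc (0 : ℝ) T ×ˢ Icc (0 : ℝ) T, ∫ z, F (rotPair (w, z)) = 0 := by
    intro w hw
    have : ∀ z, F (rotPair (w, z)) = 0 := by
      intro z
      refine hFzero _ fun hmem => hw ?_
      simp only [rotPair, mem_prod, hD, domain_eq] at hmem
      obtain ⟨⟨p, hp, hp'⟩, ⟨p', hq, hq'⟩⟩ := hmem
      rw [EmbeddingLike.apply_eq_iff_eq] at hp' hq'
      subst hp' hq'
      exact ⟨hp.1.2, hq.1.2⟩
    simp [this]
  rw [← setIntegral_eq_integral_of_forall_compl_eq_zero hout, ← integral_const_mul]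
  refine integral_congr_ae (Eventually.of_forall fun w => ?_)
  simp only
  rw [← integral_const_mul, ← integral_const_mul]
  refine integral_congr_ae (Eventually.of_forall fun z => ?_)
  simp only [hF, rotPair, noiseDensity, ContinuousLinearEquiv.symm_apply_apply]
  change _ * (_ * (_ * (φ (rot45 (w.1, z.1)) * ψ (rot45 (w.2, z.2))))) = _
  ring

/-! ### Moments of centered Gaussian variables -/

/-- The even absolute moments of the standard Gaussian law. -/
def gaussMoment (k : ℕ) : ℝ≥0∞ := ∫⁻ x, ‖x‖ₑ ^ (2 * k) ∂(gaussianReal 0 1)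

lemma gaussMoment_lt_top (k : ℕ) : gaussMoment k < ⊤ := by
  rcases Nat.eq_zero_or_pos k with rfl | hk
  · simp [gaussMoment]
  have h := (memLp_id_gaussianReal (μ := 0) (v := 1) (2 * k : ℕ)).eLpNorm_lt_top
  have hk' : ((2 * k : ℕ) : ℝ≥0∞) ≠ 0 := by
    exact_mod_cast (by omega : 2 * k ≠ 0)
  have h2 := lintegral_rpow_enorm_lt_top_of_eLpNorm_lt_top (p := ((2 * k : ℕ) : ℝ≥0∞))
    hk' (ENNReal.natCast_ne_top _) (by exact_mod_cast h)
  simpa [gaussMoment, ← ENNReal.rpow_natCast] using h2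

lemma lintegral_enorm_pow_of_hasGaussianLaw {Ω : Type*} [MeasurableSpace Ω] {P : Measure Ω}
    {Y : Ω → ℝ} (hY : HasGaussianLaw Y P) (h0 : ∫ ω, Y ω ∂P = 0) (k : ℕ) :
    ∫⁻ ω, ‖Y ω‖ₑ ^ (2 * k) ∂P = gaussMoment k * ENNReal.ofReal (∫ ω, Y ω * Y ω ∂P) ^ k := by
  have hvar : Var[Y; P] = ∫ ω, Y ω * Y ω ∂P := by
    rw [variance_of_integral_eq_zero hY.aemeasurable h0]
    simp [sq]
  set v := ∫ ω, Y ω * Y ω ∂P with hv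
  have hv0 : 0 ≤ v := integral_nonneg fun _ => mul_self_nonneg _
  have hlaw : P.map Y = (gaussianReal 0 1).map (fun x => √v * x) := by
    rw [hY.map_eq_gaussianReal, h0, hvar, gaussianReal_map_const_mul]
    congr 1
    · simp
    · ext; simp [Real.sq_sqrt hv0, hv0]
  calc ∫⁻ ω, ‖Y ω‖ₑ ^ (2 * k) ∂P = ∫⁻ x, ‖x‖ₑ ^ (2 * k) ∂(P.map Y) := by
        rw [lintegral_map' (by fun_prop) hY.aemeasurable]
    _ = ∫⁻ x, ‖√v * x‖ₑ ^ (2 * k) ∂(gaussianReal 0 1) := by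
        rw [hlaw, lintegral_map (by fun_prop) (by fun_prop)]
    _ = ∫⁻ x, ENNReal.ofReal v ^ k * ‖x‖ₑ ^ (2 * k) ∂(gaussianReal 0 1) := by
        refine lintegral_congr fun x => ?_
        rw [enorm_mul, mul_pow, pow_mul, Real.enorm_eq_ofReal (Real.sqrt_nonneg _),
          ← ENNReal.ofReal_pow (Real.sqrt_nonneg _), Real.sq_sqrt hv0]
    _ = _ := by rw [lintegral_const_mul _ (by fun_prop), mul_comm, gaussMoment]

/-! ### Wiener integrals with respect to a Gaussian noise -/

/-- The Gaussian family `Y` has, on test functions supported in `D`, a covariance given by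
integration against the measure `m`. -/
structure HasCovMeasure {Ω : Type*} [MeasurableSpace Ω] (P : Measure Ω) (Y : PlaneTest → Ω → ℝ)
    (D : Set (ℝ × ℝ)) (m : Measure ((ℝ × ℝ) × (ℝ × ℝ))) : Prop where
  gaussian : ∀ φ, HasGaussianLaw (Y φ) P
  centered : ∀ φ, ∫ ω, Y φ ω ∂P = 0
  cov : ∀ φ ψ : PlaneTest, tsupport φ ⊆ D → tsupport ψ ⊆ D →
    ∫ ω, Y φ ω * Y ψ ω ∂P = ∫ z, φ z.1 * ψ z.2 ∂m
  finite : IsFiniteMeasure m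
  ac : m ≪ volume

/-- `(φ n)` is a uniformly bounded sequence of test functions supported in `D` that converges
almost everywhere to `g`. -/
structure ApproxFun (D : Set (ℝ × ℝ)) (g : ℝ × ℝ → ℝ) (φ : ℕ → PlaneTest) : Prop where
  support : ∀ n, tsupport (φ n) ⊆ D
  bounded : ∃ M : ℝ, ∀ n p, |φ n p| ≤ M
  tendsto : ∀ᵐ p ∂(volume : Measure (ℝ × ℝ)), Tendsto (fun n => φ n p) atTop (𝓝 (g p))

lemma IsApproximating.approxFun {D A : Set (ℝ × ℝ)} {φ : ℕ → PlaneTest}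
    (h : IsApproximating D A φ) : ApproxFun D (A.indicator fun _ => 1) φ :=
  ⟨h.support, h.bounded, h.tendsto⟩

lemma tsupport_linearCombination_subset {D : Set (ℝ × ℝ)} {φ ψ : PlaneTest}
    (hφ : tsupport φ ⊆ D) (hψ : tsupport ψ ⊆ D) (a b : ℝ) :
    tsupport (a • φ + b • ψ : PlaneTest) ⊆ D := by
  have hφ' : tsupport (fun x => a • φ x) ⊆ tsupport φ := tsupport_smul_subset_right (fun _ => a) φ
  have hψ' : tsupport (fun x => b • ψ x) ⊆ tsupport ψ := tsupport_smul_subset_right (fun _ => b) ψ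
  exact (tsupport_add (fun x => a • φ x) (fun x => b • ψ x)).trans
    (union_subset (hφ'.trans hφ) (hψ'.trans hψ))

lemma ApproxFun.linearCombination {D : Set (ℝ × ℝ)} {g h : ℝ × ℝ → ℝ} {φ ψ : ℕ → PlaneTest}
    (hφ : ApproxFun D g φ) (hψ : ApproxFun D h ψ) (a b : ℝ) :
    ApproxFun D (fun p => a * g p + b * h p) (fun n => a • φ n + b • ψ n) := by
  obtain ⟨M, hM⟩ := hφ.bounded
  obtain ⟨N, hN⟩ := hψ.bounded
  refine ⟨fun n => tsupport_linearCombination_subset (hφ.support n) (hψ.support n) a b,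
    ⟨|a| * M + |b| * N, fun n p => ?_⟩, ?_⟩
  · change |a * φ n p + b * ψ n p| ≤ _
    refine (abs_add_le _ _).trans ?_
    rw [abs_mul, abs_mul]
    have := hM n p
    have := hN n p
    gcongr
  · filter_upwards [hφ.tendsto, hψ.tendsto] with p hp hp'
    exact (hp.const_mul a).add (hp'.const_mul b)

lemma ApproxFun.congr {D : Set (ℝ × ℝ)} {g h : ℝ × ℝ → ℝ} {φ : ℕ → PlaneTest}
    (hφ : ApproxFun D g φ) (hgh : g =ᵐ[volume] h) : ApproxFun D h φ := by
  refine ⟨hφ.support, hφ.bounded, ?_⟩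
  filter_upwards [hφ.tendsto, hgh] with p hp hp'
  rwa [← hp']

/-- The random variable `ξ` is the Wiener integral of `g`, as a limit in `L²` along an
approximating sequence of test functions. -/
structure IsWienerIntegral {Ω : Type*} [MeasurableSpace Ω] (P : Measure Ω)
    (Y : PlaneTest → Ω → ℝ) (D : Set (ℝ × ℝ)) (g : ℝ × ℝ → ℝ) (ξ : Ω → ℝ) : Prop where
  memLp : MemLp ξ 2 P
  exists_approx : ∃ φ, ApproxFun D g φ ∧
    Tendsto (fun n => eLpNorm (Y (φ n) - ξ) 2 P) atTop (𝓝 0)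

lemma IsWienerIntegral.congr {Ω : Type*} [MeasurableSpace Ω] {P : Measure Ω}
    {Y : PlaneTest → Ω → ℝ} {D : Set (ℝ × ℝ)} {g h : ℝ × ℝ → ℝ} {ξ : Ω → ℝ}
    (hξ : IsWienerIntegral P Y D g ξ) (hgh : g =ᵐ[volume] h) : IsWienerIntegral P Y D h ξ := by
  obtain ⟨φ, hφ, hlim⟩ := hξ.exists_approx
  exact ⟨hξ.memLp, φ, hφ.congr hgh, hlim⟩

lemma IsRotatedNoiseOfSet.isWienerIntegral {Ω : Type*} [MeasurableSpace Ω] {P : Measure Ω}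
    {X : PlaneTest → Ω → ℝ} {D A : Set (ℝ × ℝ)} {ξ : Ω → ℝ}
    (hξ : IsRotatedNoiseOfSet P X D A ξ) :
    IsWienerIntegral P (rotatedNoise X) D (A.indicator fun _ => 1) ξ := by
  obtain ⟨φ, hφ⟩ := hξ.exists_approx
  exact ⟨hξ.memLp, φ, hφ.approxFun, hξ.tendsto φ hφ⟩

namespace HasCovMeasure

variable {Ω : Type*} [MeasurableSpace Ω] {P : Measure Ω} {Y : PlaneTest → Ω → ℝ}
  {D : Set (ℝ × ℝ)} {m : Measure ((ℝ × ℝ) × (ℝ × ℝ))}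

lemma memLp_two (hY : HasCovMeasure P Y D m) (φ : PlaneTest) : MemLp (Y φ) 2 P :=
  (hY.gaussian φ).memLp_two

lemma integrable_mul_test (hY : HasCovMeasure P Y D m) (φ ψ : PlaneTest) :
    Integrable (fun z => φ z.1 * ψ z.2) m := by
  have := hY.finite
  obtain ⟨A, hA⟩ := φ.hasCompactSupport.exists_bound_of_continuous φ.continuous
  obtain ⟨B, hB⟩ := ψ.hasCompactSupport.exists_bound_of_continuous ψ.continuous
  refine Integrable.of_bound (C := A * B) ?_ (Eventually.of_forall fun z => ?_)
  · exact ((φ.continuous.comp continuous_fst).mul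
      (ψ.continuous.comp continuous_snd)).aestronglyMeasurable
  · rw [norm_mul]
    exact mul_le_mul (hA _) (hB _) (norm_nonneg _) ((norm_nonneg _).trans (hA 0))

/-- `Y` is not assumed linear, so the second moment of a combination of its values is obtained by
expanding the square. -/
lemma integral_sum_mul_sum (hY : HasCovMeasure P Y D m) {ι : Type*} [Fintype ι] (c : ι → ℝ)
    (φ : ι → PlaneTest) (hφ : ∀ i, tsupport (φ i) ⊆ D) :
    ∫ ω, (∑ i, c i * Y (φ i) ω) * (∑ i, c i * Y (φ i) ω) ∂P =
      ∫ z, (∑ i, c i * φ i z.1) * (∑ i, c i * φ i z.2) ∂m := by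
  simp only [Finset.sum_mul_sum, mul_mul_mul_comm]
  have h1 : ∀ i j, Integrable (fun ω => c i * c j * (Y (φ i) ω * Y (φ j) ω)) P := fun i j =>
    ((hY.memLp_two (φ i)).integrable_mul (hY.memLp_two (φ j))).const_mul _
  have h2 : ∀ i j, Integrable (fun z => c i * c j * (φ i z.1 * φ j z.2)) m := fun i j =>
    (hY.integrable_mul_test (φ i) (φ j)).const_mul _
  rw [integral_finsetSum _ fun i _ => integrable_finsetSum _ fun j _ => h1 i j,
    integral_finsetSum _ fun i _ => integrable_finsetSum _ fun j _ => h2 i j]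
  refine Finset.sum_congr rfl fun i _ => ?_
  rw [integral_finsetSum _ fun j _ => h1 i j, integral_finsetSum _ fun j _ => h2 i j]
  refine Finset.sum_congr rfl fun j _ => ?_
  rw [integral_const_mul, integral_const_mul, hY.cov _ _ (hφ i) (hφ j)]

/-- Linearity is forced by the covariance: the defect has second moment zero. -/
lemma map_linearCombination (hY : HasCovMeasure P Y D m) {φ ψ : PlaneTest}
    (hφ : tsupport φ ⊆ D) (hψ : tsupport ψ ⊆ D) (a b : ℝ) :
    Y (a • φ + b • ψ) =ᵐ[P] fun ω => a * Y φ ω + b * Y ψ ω := by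
  have hs := tsupport_linearCombination_subset hφ hψ a b
  have h := hY.integral_sum_mul_sum ![1, -a, -b] ![a • φ + b • ψ, φ, ψ]
    (fun i => by fin_cases i <;> assumption)
  have hz : ∀ p, (a • φ + b • ψ : PlaneTest) p = a * φ p + b * ψ p := fun p => rfl
  simp only [Fin.sum_univ_three, Matrix.cons_val_zero, Matrix.cons_val_one, Matrix.cons_val,
    hz] at h
  have h0 : ∀ z : (ℝ × ℝ) × (ℝ × ℝ), (1 * (a * φ z.1 + b * ψ z.1) + -a * φ z.1 + -b * ψ z.1) *
      (1 * (a * φ z.2 + b * ψ z.2) + -a * φ z.2 + -b * ψ z.2) = 0 := fun z => by ring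
  simp only [h0, integral_zero] at h
  have hL : MemLp (fun ω => 1 * Y (a • φ + b • ψ) ω + -a * Y φ ω + -b * Y ψ ω) 2 P :=
    (((hY.memLp_two _).const_mul 1).add ((hY.memLp_two φ).const_mul (-a))).add
      ((hY.memLp_two ψ).const_mul (-b))
  rw [integral_eq_zero_iff_of_nonneg (fun _ => mul_self_nonneg _) (hL.integrable_mul hL)] at h
  filter_upwards [h] with ω hω
  have := mul_self_eq_zero.1 hω
  linarith

lemma ae_tendsto_prod (hY : HasCovMeasure P Y D m) {ι : Type*} {l : Filter ι}
    {f : ι → ℝ × ℝ → ℝ} {g : ℝ × ℝ → ℝ}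
    (h : ∀ᵐ p ∂(volume : Measure (ℝ × ℝ)), Tendsto (fun i => f i p) l (𝓝 (g p))) :
    ∀ᵐ z ∂m, Tendsto (fun i => f i z.1 * f i z.2) l (𝓝 (g z.1 * g z.2)) := by
  have h1 := (Measure.quasiMeasurePreserving_fst (μ := (volume : Measure (ℝ × ℝ)))
    (ν := (volume : Measure (ℝ × ℝ)))).ae h
  have h2 := (Measure.quasiMeasurePreserving_snd (μ := (volume : Measure (ℝ × ℝ)))
    (ν := (volume : Measure (ℝ × ℝ)))).ae h
  filter_upwards [hY.ac.ae_le h1, hY.ac.ae_le h2] with z hz1 hz2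
  exact hz1.mul hz2

/-- Dominated convergence for the quadratic form of the covariance. -/
lemma tendsto_integral_mul (hY : HasCovMeasure P Y D m) {ι : Type*} {l : Filter ι}
    [l.IsCountablyGenerated] {f : ι → ℝ × ℝ → ℝ} {g : ℝ × ℝ → ℝ} {M : ℝ}
    (hf : ∀ i, Measurable (f i)) (hM : ∀ i p, |f i p| ≤ M)
    (h : ∀ᵐ p ∂(volume : Measure (ℝ × ℝ)), Tendsto (fun i => f i p) l (𝓝 (g p))) :
    Tendsto (fun i => ∫ z, f i z.1 * f i z.2 ∂m) l (𝓝 (∫ z, g z.1 * g z.2 ∂m)) := by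
  have := hY.finite
  refine tendsto_integral_filter_of_dominated_convergence (fun _ => M * M) ?_ ?_
    (integrable_const _) (hY.ae_tendsto_prod h)
  · exact Eventually.of_forall fun i =>
      (((hf i).comp measurable_fst).mul ((hf i).comp measurable_snd)).aestronglyMeasurable
  · refine Eventually.of_forall fun i => Eventually.of_forall fun z => ?_
    rw [norm_mul]
    exact mul_le_mul (hM i _) (hM i _) (norm_nonneg _) ((abs_nonneg _).trans (hM i z.1))

lemma lintegral_enorm_pow_test (hY : HasCovMeasure P Y D m) {φ : PlaneTest}
    (hφ : tsupport φ ⊆ D) (k : ℕ) :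
    ∫⁻ ω, ‖Y φ ω‖ₑ ^ (2 * k) ∂P =
      gaussMoment k * ENNReal.ofReal (∫ z, φ z.1 * φ z.2 ∂m) ^ k := by
  rw [lintegral_enorm_pow_of_hasGaussianLaw (hY.gaussian φ) (hY.centered φ), hY.cov _ _ hφ hφ]

/-- Fatou's lemma along an almost surely convergent subsequence, the Gaussian moments of the
approximations converging with their variances. -/
lemma lintegral_enorm_pow_le (hY : HasCovMeasure P Y D m) {g : ℝ × ℝ → ℝ} {ξ : Ω → ℝ}
    (hξ : IsWienerIntegral P Y D g ξ) (k : ℕ) :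
    ∫⁻ ω, ‖ξ ω‖ₑ ^ (2 * k) ∂P ≤
      gaussMoment k * ENNReal.ofReal (∫ z, g z.1 * g z.2 ∂m) ^ k := by
  obtain ⟨φ, hφ, hlim⟩ := hξ.exists_approx
  obtain ⟨M, hM⟩ := hφ.bounded
  obtain ⟨ns, hns, hae⟩ := (tendstoInMeasure_of_tendsto_eLpNorm two_ne_zero
    (fun n => (hY.memLp_two (φ n)).1) hξ.memLp.1 hlim).exists_seq_tendsto_ae
  have hinteg := hY.tendsto_integral_mul (fun n => (φ n).continuous.measurable) hM hφ.tendsto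
  have hcont : Tendsto (fun i => gaussMoment k *
      ENNReal.ofReal (∫ z, φ (ns i) z.1 * φ (ns i) z.2 ∂m) ^ k) atTop
      (𝓝 (gaussMoment k * ENNReal.ofReal (∫ z, g z.1 * g z.2 ∂m) ^ k)) := by
    refine ENNReal.Tendsto.const_mul ?_ (Or.inr (gaussMoment_lt_top k).ne)
    exact ENNReal.Tendsto.pow
      (ENNReal.tendsto_ofReal (hinteg.comp hns.tendsto_atTop))
  calc ∫⁻ ω, ‖ξ ω‖ₑ ^ (2 * k) ∂P
      = ∫⁻ ω, liminf (fun i => ‖Y (φ (ns i)) ω‖ₑ ^ (2 * k)) atTop ∂P := by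
        refine lintegral_congr_ae ?_
        filter_upwards [hae] with ω hω
        exact (ENNReal.Tendsto.pow hω.enorm).liminf_eq.symm
    _ ≤ liminf (fun i => ∫⁻ ω, ‖Y (φ (ns i)) ω‖ₑ ^ (2 * k) ∂P) atTop :=
        lintegral_liminf_le' fun i =>
          ((hY.gaussian (φ (ns i))).aemeasurable.enorm.pow_const _)
    _ = _ := by
        simp only [fun i => hY.lintegral_enorm_pow_test (hφ.support (ns i)) k]
        exact hcont.liminf_eq

lemma isWienerIntegral_linearCombination (hY : HasCovMeasure P Y D m) {g h : ℝ × ℝ → ℝ}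
    {ξ ζ : Ω → ℝ} (hξ : IsWienerIntegral P Y D g ξ) (hζ : IsWienerIntegral P Y D h ζ) (a b : ℝ) :
    IsWienerIntegral P Y D (fun p => a * g p + b * h p) (fun ω => a * ξ ω + b * ζ ω) := by
  obtain ⟨φ, hφ, hφlim⟩ := hξ.exists_approx
  obtain ⟨ψ, hψ, hψlim⟩ := hζ.exists_approx
  refine ⟨(hξ.memLp.const_mul a).add (hζ.memLp.const_mul b), _, hφ.linearCombination hψ a b, ?_⟩
  have hlim : Tendsto (fun n => ‖a‖ₑ * eLpNorm (Y (φ n) - ξ) 2 P +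
      ‖b‖ₑ * eLpNorm (Y (ψ n) - ζ) 2 P) atTop (𝓝 0) := by
    have h1 := ENNReal.Tendsto.const_mul (a := ‖a‖ₑ) hφlim (Or.inr enorm_ne_top)
    have h2 := ENNReal.Tendsto.const_mul (a := ‖b‖ₑ) hψlim (Or.inr enorm_ne_top)
    simpa using h1.add h2
  refine tendsto_of_tendsto_of_tendsto_of_le_of_le tendsto_const_nhds hlim
    (fun _ => zero_le) fun n => ?_
  have hae : Y (a • φ n + b • ψ n) - (fun ω => a * ξ ω + b * ζ ω) =ᵐ[P]
      a • (Y (φ n) - ξ) + b • (Y (ψ n) - ζ) := by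
    filter_upwards [hY.map_linearCombination (hφ.support n) (hψ.support n) a b] with ω hω
    simp only [Pi.sub_apply, Pi.add_apply, Pi.smul_apply, smul_eq_mul, hω]
    ring
  simp only
  rw [eLpNorm_congr_ae hae, ← eLpNorm_const_smul, ← eLpNorm_const_smul]
  exact eLpNorm_add_le (((hY.memLp_two _).sub hξ.memLp).const_smul a).1
    (((hY.memLp_two _).sub hζ.memLp).const_smul b).1 (by norm_num)

lemma ae_eq_zero_of_isWienerIntegral (hY : HasCovMeasure P Y D m) {g : ℝ × ℝ → ℝ} {ξ : Ω → ℝ}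
    (hξ : IsWienerIntegral P Y D g ξ) (hg : ∫ z, g z.1 * g z.2 ∂m = 0) : ξ =ᵐ[P] 0 := by
  have h := hY.lintegral_enorm_pow_le hξ 1
  rw [hg] at h
  simp only [ENNReal.ofReal_zero, pow_one, mul_zero, nonpos_iff_eq_zero, mul_one] at h
  rw [lintegral_eq_zero_iff' (hξ.memLp.1.enorm.pow_const 2)] at h
  filter_upwards [h] with ω hω
  simpa using hω

lemma ae_eq_of_isWienerIntegral (hY : HasCovMeasure P Y D m) {g : ℝ × ℝ → ℝ} {ξ ζ : Ω → ℝ}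
    (hξ : IsWienerIntegral P Y D g ξ) (hζ : IsWienerIntegral P Y D g ζ) : ξ =ᵐ[P] ζ := by
  have h := hY.isWienerIntegral_linearCombination hξ hζ 1 (-1)
  filter_upwards [hY.ae_eq_zero_of_isWienerIntegral h (by simp)] with ω hω
  simp only [Pi.zero_apply] at hω
  linarith

/-- Along an approximating sequence, the noise converges in `L²`. -/
lemma exists_tendsto_eLpNorm (hY : HasCovMeasure P Y D m) {g : ℝ × ℝ → ℝ} {φ : ℕ → PlaneTest}
    (hφ : ApproxFun D g φ) :
    ∃ ξ, MemLp ξ 2 P ∧ Tendsto (fun n => eLpNorm (Y (φ n) - ξ) 2 P) atTop (𝓝 0) := by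
  obtain ⟨M, hM⟩ := hφ.bounded
  have : Fact ((1 : ℝ≥0∞) ≤ 2) := ⟨by norm_num⟩
  set F : ℕ → Lp ℝ 2 P := fun n => (hY.memLp_two (φ n)).toLp (Y (φ n)) with hF
  have hFn : ∀ n, F n =ᵐ[P] Y (φ n) := fun n => MemLp.coeFn_toLp _
  -- Indexing by pairs turns the Cauchy property into a single limit, to which dominated convergence
  -- for the quadratic form applies.
  have hsq : ∀ n : ℕ × ℕ, eLpNorm (⇑(F n.1) - ⇑(F n.2)) 2 P = ENNReal.ofReal
      ((∫ z, (φ n.1 z.1 - φ n.2 z.1) * (φ n.1 z.2 - φ n.2 z.2) ∂m) ^ ((2 : ℝ)⁻¹)) := by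
    intro n
    rw [eLpNorm_congr_ae ((hFn n.1).sub (hFn n.2)),
      ((hY.memLp_two (φ n.1)).sub (hY.memLp_two (φ n.2))).eLpNorm_eq_integral_rpow_norm
        two_ne_zero (by norm_num)]
    have h := hY.integral_sum_mul_sum ![1, -1] ![φ n.1, φ n.2]
      (fun i => by fin_cases i <;> exact hφ.support _)
    simp only [Fin.sum_univ_two, Matrix.cons_val_zero, Matrix.cons_val_one, one_mul, neg_mul,
      ← sub_eq_add_neg] at h
    rw [← h]
    simp [sq]
  have hcauchy : CauchySeq F := by
    rw [Lp.cauchySeq_Lp_iff_cauchySeq_eLpNorm]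
    simp only [hsq]
    have hlim := hY.tendsto_integral_mul (l := (atTop : Filter (ℕ × ℕ)))
      (f := fun n p => φ n.1 p - φ n.2 p) (g := fun _ => 0) (M := M + M)
      (fun n => (φ n.1).continuous.measurable.sub (φ n.2).continuous.measurable)
      (fun n p => (abs_sub _ _).trans (add_le_add (hM _ _) (hM _ _))) (by
        filter_upwards [hφ.tendsto] with p hp
        rw [← prod_atTop_atTop_eq]
        simpa using (hp.comp tendsto_fst).sub (hp.comp tendsto_snd))
    have h2 := ENNReal.tendsto_ofReal (hlim.rpow_const (p := (2 : ℝ)⁻¹) (Or.inr (by norm_num)))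
    simpa using h2
  obtain ⟨ξ, hξ⟩ := cauchySeq_tendsto_of_complete hcauchy
  refine ⟨ξ, Lp.memLp ξ, ?_⟩
  rw [Lp.tendsto_Lp_iff_tendsto_eLpNorm'] at hξ
  refine hξ.congr fun n => eLpNorm_congr_ae ((hFn n).sub (EventuallyEq.refl _ _))

lemma tendsto_eLpNorm_of_isWienerIntegral (hY : HasCovMeasure P Y D m) {g : ℝ × ℝ → ℝ}
    {ξ : Ω → ℝ} (hξ : IsWienerIntegral P Y D g ξ) {φ : ℕ → PlaneTest} (hφ : ApproxFun D g φ) :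
    Tendsto (fun n => eLpNorm (Y (φ n) - ξ) 2 P) atTop (𝓝 0) := by
  obtain ⟨ζ, hζ, hlim⟩ := hY.exists_tendsto_eLpNorm hφ
  have h := hY.ae_eq_of_isWienerIntegral hξ ⟨hζ, φ, hφ, hlim⟩
  exact hlim.congr fun n => eLpNorm_congr_ae ((EventuallyEq.refl _ _).sub h.symm)

end HasCovMeasure

/-! ### Approximation of indicator functions of convex sets -/

-- Smooth cutoffs equal to 1 on closed sets exhausting the interior do the job, since the boundary
-- of a convex set is Lebesgue-null. Closedness of A keeps their supports inside it.
open scoped Manifold ContDiff in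
lemma exists_isApproximating {D A : Set (ℝ × ℝ)} (hD : IsCompact D) (hAD : A ⊆ D)
    (hA : IsClosed A) (hconv : Convex ℝ A) : ∃ φ, IsApproximating D A φ := by
  obtain ⟨F, hFc, hFsub, hFU, hmono⟩ := (isOpen_interior (s := A)).exists_iUnion_isClosed
  have hex : ∀ n, ∃ φ : PlaneTest, tsupport φ ⊆ A ∧ (∀ p, φ p ∈ Icc (0 : ℝ) 1) ∧
      (∀ p ∈ F n, φ p = 1) ∧ ∀ p ∉ interior A, φ p = 0 := by
    intro n
    obtain ⟨f, h1, h0, h01⟩ := exists_contMDiffMap_one_nhds_of_subset_interior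
      (𝓘(ℝ, ℝ × ℝ)) (n := ⊤) (hFc n) ((hFsub n).trans interior_interior.symm.subset)
    have hsupp : tsupport f ⊆ A :=
      closure_minimal (fun p hp => by
        by_contra hpA
        exact hp (h0 p fun h => hpA (interior_subset h))) hA
    refine ⟨⟨f, f.contMDiff.contDiff, ?_, fun _ _ => trivial⟩, hsupp, h01, ?_, h0⟩
    · exact hD.of_isClosed_subset (isClosed_tsupport f) (hsupp.trans hAD)
    · intro p hp
      exact (h1.self_of_nhdsSet p hp)
  choose φ hφ using hex
  refine ⟨φ, fun n => (hφ n).1.trans hAD, ⟨1, fun n p => ?_⟩, ?_⟩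
  · rw [abs_of_nonneg ((hφ n).2.1 p).1]
    exact ((hφ n).2.1 p).2
  · have hfr : ∀ᵐ p ∂(volume : Measure (ℝ × ℝ)), p ∉ frontier A :=
      measure_eq_zero_iff_ae_notMem.1 (hconv.addHaar_frontier volume)
    filter_upwards [hfr] with p hp
    by_cases hpi : p ∈ interior A
    · rw [indicator_of_mem (interior_subset hpi)]
      rw [← hFU, mem_iUnion] at hpi
      obtain ⟨N, hN⟩ := hpi
      refine tendsto_const_nhds.congr' ?_
      filter_upwards [eventually_ge_atTop N] with n hn
      exact ((hφ n).2.2.1 p (hmono hn hN)).symm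
    · have hpA : p ∉ A := fun h => hp ⟨subset_closure h, hpi⟩
      rw [indicator_of_notMem hpA]
      simp only [fun n => (hφ n).2.2.2 p hpi]
      exact tendsto_const_nhds

/-! ### Dyadic approximation -/

/-- The dyadic approximation from below of a real number at level `n`. -/
def dyadicFloor (n : ℕ) (s : ℝ) : ℝ := ⌊(2 : ℝ) ^ n * s⌋ / 2 ^ n

/-- The set of dyadic numbers. -/
def dyadics : Set ℝ := {s | ∃ (n : ℕ) (i : ℤ), s = i / 2 ^ n}

lemma dyadicFloor_mem (n : ℕ) (s : ℝ) : dyadicFloor n s ∈ dyadics := ⟨n, _, rfl⟩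

lemma zero_mem_dyadics : (0 : ℝ) ∈ dyadics := ⟨0, 0, by simp⟩

lemma dyadicFloor_zero (n : ℕ) : dyadicFloor n 0 = 0 := by simp [dyadicFloor]

lemma dyadicFloor_le (n : ℕ) (s : ℝ) : dyadicFloor n s ≤ s := by
  rw [dyadicFloor, div_le_iff₀ (by positivity), mul_comm s]
  exact Int.floor_le _

lemma sub_lt_dyadicFloor (n : ℕ) (s : ℝ) : s - (1 / 2) ^ n < dyadicFloor n s := by
  rw [dyadicFloor, lt_div_iff₀ (by positivity), sub_mul, ← mul_pow]
  have := Int.sub_one_lt_floor ((2 : ℝ) ^ n * s)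
  norm_num
  linarith

lemma tendsto_dyadicFloor (s : ℝ) : Tendsto (fun n => dyadicFloor n s) atTop (𝓝 s) := by
  refine tendsto_of_tendsto_of_tendsto_of_le_of_le (g := fun n : ℕ => s - (1 / 2 : ℝ) ^ n) ?_
    tendsto_const_nhds (fun n => (sub_lt_dyadicFloor n s).le) (fun n => dyadicFloor_le n s)
  simpa using tendsto_const_nhds.sub
    (tendsto_pow_atTop_nhds_zero_of_lt_one (r := (1 / 2 : ℝ)) (by norm_num) (by norm_num))

lemma abs_dyadicFloor_sub_le (n : ℕ) (s : ℝ) : |dyadicFloor n s - s| ≤ 1 := by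
  have h1 := dyadicFloor_le n s
  have h2 := sub_lt_dyadicFloor n s
  have h3 : (1 / 2 : ℝ) ^ n ≤ 1 := pow_le_one₀ (by norm_num) (by norm_num)
  rw [abs_le]; constructor <;> linarith

lemma dyadicFloor_eq_of_le {N n : ℕ} (i : ℤ) (h : N ≤ n) :
    dyadicFloor n ((i : ℝ) / 2 ^ N) = i / 2 ^ N := by
  obtain ⟨k, rfl⟩ := Nat.exists_eq_add_of_le h
  have : (2 : ℝ) ^ (N + k) * (i / 2 ^ N) = ((i * 2 ^ k : ℤ) : ℝ) := by
    push_cast; rw [pow_add]; field_simp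
  rw [dyadicFloor, this, Int.floor_intCast]
  push_cast
  rw [pow_add]; field_simp

section OneDim

variable {f : ℝ → ℝ} {K ρ : ℝ}

lemma abs_sub_dyadicFloor_succ_le (hK : 0 ≤ K) (hρ : 0 < ρ)
    (hf : ∀ (n : ℕ) (i : ℤ), |f (((i : ℝ) + 1) / 2 ^ n) - f (i / 2 ^ n)| ≤ K * ρ ^ n)
    (n : ℕ) (s : ℝ) : |f (dyadicFloor (n + 1) s) - f (dyadicFloor n s)| ≤ K * ρ ^ (n + 1) := by
  set i := ⌊(2 : ℝ) ^ n * s⌋ with hi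
  have h1 := Int.floor_le ((2 : ℝ) ^ n * s)
  have h2 := Int.lt_floor_add_one ((2 : ℝ) ^ n * s)
  rw [← hi] at h1 h2
  have hd : dyadicFloor n s = ((2 * i : ℤ) : ℝ) / 2 ^ (n + 1) := by
    rw [dyadicFloor, ← hi]; push_cast; rw [pow_succ]; field_simp
  have hcase : ⌊(2 : ℝ) ^ (n + 1) * s⌋ = 2 * i ∨ ⌊(2 : ℝ) ^ (n + 1) * s⌋ = 2 * i + 1 := by
    have h3 : 2 * i ≤ ⌊(2 : ℝ) ^ (n + 1) * s⌋ := by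
      rw [Int.le_floor, pow_succ]; push_cast; linarith
    have h4 : ⌊(2 : ℝ) ^ (n + 1) * s⌋ < 2 * i + 2 := by
      rw [Int.floor_lt, pow_succ]; push_cast; linarith
    omega
  rcases hcase with h | h
  · rw [hd, dyadicFloor, h, sub_self, abs_zero]; positivity
  · rw [hd, dyadicFloor, h]
    have := hf (n + 1) (2 * i)
    push_cast at this ⊢
    exact this

/-- Chaining through successive levels. The factor 1 - ρ^k is the partial geometric sum, kept so
that the induction closes. -/
lemma abs_sub_dyadicFloor_add_le (hK : 0 ≤ K) (hρ : 0 < ρ) (hρ1 : ρ < 1)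
    (hf : ∀ (n : ℕ) (i : ℤ), |f (((i : ℝ) + 1) / 2 ^ n) - f (i / 2 ^ n)| ≤ K * ρ ^ n)
    (n k : ℕ) (s : ℝ) :
    |f (dyadicFloor (n + k) s) - f (dyadicFloor n s)| ≤ K * ρ ^ n / (1 - ρ) * (1 - ρ ^ k) := by
  have h1 : 0 < 1 - ρ := by linarith
  induction k with
  | zero => simp
  | succ k ih =>
    have h := abs_sub_dyadicFloor_succ_le hK hρ hf (n + k) s
    have h2 : K * ρ ^ (n + k + 1) ≤ K * ρ ^ n / (1 - ρ) * (ρ ^ k - ρ ^ (k + 1)) := by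
      have : K * ρ ^ n / (1 - ρ) * (ρ ^ k - ρ ^ (k + 1)) = K * ρ ^ (n + k) := by
        rw [pow_succ, pow_add]; field_simp
      rw [this]
      exact mul_le_mul_of_nonneg_left (pow_le_pow_of_le_one hρ.le hρ1.le (by omega)) hK
    have h3 := abs_sub_le (f (dyadicFloor (n + (k + 1)) s)) (f (dyadicFloor (n + k) s))
      (f (dyadicFloor n s))
    rw [← add_assoc] at h3 ⊢
    calc _ ≤ _ := h3
      _ ≤ K * ρ ^ n / (1 - ρ) * (ρ ^ k - ρ ^ (k + 1)) +
          K * ρ ^ n / (1 - ρ) * (1 - ρ ^ k) := add_le_add (h.trans h2) ih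
      _ = _ := by ring

lemma abs_sub_dyadicFloor_le (hK : 0 ≤ K) (hρ : 0 < ρ) (hρ1 : ρ < 1)
    (hf : ∀ (n : ℕ) (i : ℤ), |f (((i : ℝ) + 1) / 2 ^ n) - f (i / 2 ^ n)| ≤ K * ρ ^ n)
    (n : ℕ) {s : ℝ} (hs : s ∈ dyadics) : |f s - f (dyadicFloor n s)| ≤ K * ρ ^ n / (1 - ρ) := by
  have h1 : 0 < 1 - ρ := by linarith
  obtain ⟨N, i, rfl⟩ := hs
  rcases le_total N n with h | h
  · rw [dyadicFloor_eq_of_le i h, sub_self, abs_zero]; positivity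
  · obtain ⟨k, rfl⟩ := Nat.exists_eq_add_of_le h
    have h2 := abs_sub_dyadicFloor_add_le hK hρ hρ1 hf n k (i / 2 ^ (n + k))
    rw [dyadicFloor_eq_of_le i le_rfl] at h2
    refine h2.trans (mul_le_of_le_one_right (by positivity) ?_)
    linarith [pow_pos hρ k]

lemma abs_sub_add_nat_le
    (hf : ∀ (n : ℕ) (i : ℤ), |f (((i : ℝ) + 1) / 2 ^ n) - f (i / 2 ^ n)| ≤ K * ρ ^ n)
    (n : ℕ) (i : ℤ) (k : ℕ) : |f (((i : ℝ) + k) / 2 ^ n) - f (i / 2 ^ n)| ≤ k * (K * ρ ^ n) := by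
  induction k with
  | zero => simp
  | succ k ih =>
    have h := hf n (i + k)
    push_cast at h ⊢
    rw [← add_assoc]
    refine (abs_sub_le _ (f (((i : ℝ) + k) / 2 ^ n)) _).trans ?_
    linarith

/-- Go from each point to its dyadic floor at the scale of t - s, then between the floors through
neighbouring cells. The constant records the two chaining tails, at most L + 1 cells, and one level
of rounding in the scale. -/
lemma abs_sub_le_of_dyadic_lt {η L s t : ℝ} (hη : 0 < η) (hK : 0 ≤ K)
    (hf : ∀ (n : ℕ) (i : ℤ), |f (((i : ℝ) + 1) / 2 ^ n) - f (i / 2 ^ n)| ≤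
      K * ((1 / 2 : ℝ) ^ η) ^ n)
    (hL : 1 ≤ L) (hs : s ∈ dyadics) (ht : t ∈ dyadics) (hst : s < t) (htL : t - s ≤ L) :
    |f t - f s| ≤ ((1 / 2 : ℝ) ^ η)⁻¹ * (2 / (1 - (1 / 2 : ℝ) ^ η) + L + 1) * K *
      (t - s) ^ η := by
  set ρ := (1 / 2 : ℝ) ^ η with hρ
  have hρ0 : 0 < ρ := by positivity
  have hρ1 : ρ < 1 := Real.rpow_lt_one (by norm_num) (by norm_num) hη
  have h1ρ : 0 < 1 - ρ := by linarith
  have main : ∀ (n : ℕ) (k : ℝ), 0 ≤ k → (2 : ℝ) ^ n * (t - s) ≤ k →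
      ρ ^ (n + 1) ≤ (t - s) ^ η → |f t - f s| ≤ ρ⁻¹ * (2 / (1 - ρ) + k + 1) * K * (t - s) ^ η := by
    intro n k hk hkn hn
    obtain ⟨j, hj⟩ : ∃ j : ℕ, ⌊(2 : ℝ) ^ n * t⌋ = ⌊(2 : ℝ) ^ n * s⌋ + j :=
      Int.le.dest (Int.floor_le_floor (by gcongr)) |>.imp fun _ h => h.symm
    have hjk : (j : ℝ) ≤ k + 1 := by
      have h1 := Int.floor_le ((2 : ℝ) ^ n * t)
      have h2 := Int.lt_floor_add_one ((2 : ℝ) ^ n * s)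
      rw [hj] at h1
      push_cast at h1
      linarith
    have h3 : |f (dyadicFloor n t) - f (dyadicFloor n s)| ≤ (k + 1) * (K * ρ ^ n) := by
      rw [dyadicFloor, dyadicFloor, hj]
      push_cast
      refine (abs_sub_add_nat_le hf n _ j).trans ?_
      gcongr
    have h4 := abs_sub_dyadicFloor_le hK hρ0 hρ1 hf n hs
    have h5 := abs_sub_dyadicFloor_le hK hρ0 hρ1 hf n ht
    rw [abs_sub_comm] at h4
    calc |f t - f s| ≤ |f t - f (dyadicFloor n t)| + |f (dyadicFloor n t) - f (dyadicFloor n s)|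
          + |f (dyadicFloor n s) - f s| := by
          refine (abs_sub_le _ (f (dyadicFloor n s)) _).trans ?_
          gcongr
          exact abs_sub_le _ _ _
      _ ≤ K * ρ ^ n / (1 - ρ) + (k + 1) * (K * ρ ^ n) + K * ρ ^ n / (1 - ρ) := by gcongr
      _ = ρ⁻¹ * (2 / (1 - ρ) + k + 1) * K * ρ ^ (n + 1) := by
          rw [pow_succ]; field_simp; ring
      _ ≤ _ := by gcongr
  have hts : 0 < t - s := sub_pos.2 hst
  rcases le_or_gt (t - s) 1 with h | h
  · obtain ⟨n, hn1, hn2⟩ := exists_nat_pow_near_of_lt_one hts h (y := (1 / 2 : ℝ)) (by norm_num)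
      (by norm_num)
    have hpow : ρ ^ (n + 1) ≤ (t - s) ^ η := by
      rw [hρ, ← Real.rpow_natCast, ← Real.rpow_mul (by norm_num), mul_comm,
        Real.rpow_mul (by norm_num), Real.rpow_natCast]
      exact Real.rpow_le_rpow (by positivity) hn1.le hη.le
    refine main n L (by linarith) ?_ hpow
    calc (2 : ℝ) ^ n * (t - s) ≤ 2 ^ n * (1 / 2) ^ n := by gcongr
      _ = 1 := by rw [← mul_pow]; norm_num
      _ ≤ L := hL
  -- For points more than 1 apart level 0 suffices, and the distance bound L limits the number of
  -- unit cells.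
  · refine main 0 L (by linarith) (by simpa using htL) ?_
    exact (pow_le_one₀ hρ0.le hρ1.le).trans (Real.one_le_rpow h.le hη.le)

end OneDim

/-- The constant in the one-dimensional dyadic Hölder estimate. -/
def dyadicConst (η L : ℝ) : ℝ := ((1 / 2 : ℝ) ^ η)⁻¹ * (2 / (1 - (1 / 2 : ℝ) ^ η) + L + 1)

lemma dyadicConst_nonneg {η L : ℝ} (hη : 0 < η) (hL : 1 ≤ L) : 0 ≤ dyadicConst η L := by
  have hρ1 : (1 / 2 : ℝ) ^ η < 1 := Real.rpow_lt_one (by norm_num) (by norm_num) hη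
  have : 0 < 1 - (1 / 2 : ℝ) ^ η := by linarith
  unfold dyadicConst
  positivity

lemma abs_sub_le_of_dyadic {f : ℝ → ℝ} {K η L s t : ℝ} (hη : 0 < η) (hK : 0 ≤ K)
    (hf : ∀ (n : ℕ) (i : ℤ), |f (((i : ℝ) + 1) / 2 ^ n) - f (i / 2 ^ n)| ≤
      K * ((1 / 2 : ℝ) ^ η) ^ n)
    (hL : 1 ≤ L) (hs : s ∈ dyadics) (ht : t ∈ dyadics) (htL : |t - s| ≤ L) :
    |f t - f s| ≤ dyadicConst η L * K * |t - s| ^ η := by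
  rcases lt_trichotomy s t with h | rfl | h
  · rw [abs_of_pos (sub_pos.2 h)] at htL ⊢
    exact abs_sub_le_of_dyadic_lt hη hK hf hL hs ht h htL
  · simp [Real.zero_rpow hη.ne']
  · rw [abs_sub_comm t s, abs_of_pos (sub_pos.2 h)] at htL ⊢
    rw [abs_sub_comm]
    exact abs_sub_le_of_dyadic_lt hη hK hf hL ht hs h htL

/-! ### Rectangular Hölder bounds -/

/-- `f` satisfies a rectangular Hölder bound, locally uniformly, on rectangles whose corners have
their coordinates in `S`. -/
def RectHolderOn (S : Set ℝ) (η η' : ℝ) (f : ℝ × ℝ → ℝ) : Prop :=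
  ∀ L : ℝ, ∃ B : ℝ, 0 ≤ B ∧ ∀ s₁ ∈ S, ∀ s₂ ∈ S, ∀ t₁ ∈ S, ∀ t₂ ∈ S,
    |s₂ - s₁| ≤ L → |t₂ - t₁| ≤ L →
      |rectIncr f s₁ s₂ t₁ t₂| ≤ B * (|s₂ - s₁| ^ η * |t₂ - t₁| ^ η')

/-- The Hölder bound on all dyadic cells. -/
def DyadicCellBound (η η' K : ℝ) (f : ℝ × ℝ → ℝ) : Prop :=
  ∀ (n m : ℕ) (i j : ℤ), |rectIncr f (i / 2 ^ n) (((i : ℝ) + 1) / 2 ^ n) (j / 2 ^ m)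
    (((j : ℝ) + 1) / 2 ^ m)| ≤ K * (((1 / 2 : ℝ) ^ η) ^ n * ((1 / 2 : ℝ) ^ η') ^ m)

lemma DyadicCellBound.mono {η η' η₀ η₀' K : ℝ} {f : ℝ × ℝ → ℝ} (hf : DyadicCellBound η η' K f)
    (hK : 0 ≤ K) (h : η₀ ≤ η) (h' : η₀' ≤ η') : DyadicCellBound η₀ η₀' K f := by
  intro n m i j
  refine (hf n m i j).trans ?_
  have h1 : (1 / 2 : ℝ) ^ η ≤ (1 / 2 : ℝ) ^ η₀ :=
    Real.rpow_le_rpow_of_exponent_ge (by norm_num) (by norm_num) h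
  have h2 : (1 / 2 : ℝ) ^ η' ≤ (1 / 2 : ℝ) ^ η₀' :=
    Real.rpow_le_rpow_of_exponent_ge (by norm_num) (by norm_num) h'
  gcongr

/-- The one-dimensional estimate is used twice: in s for the difference across one dyadic strip in
t, then in t for the difference between s₁ and s₂, whose cell bounds come from the first use. -/
lemma DyadicCellBound.rectHolderOn {η η' K : ℝ} {f : ℝ × ℝ → ℝ} (hη : 0 < η) (hη' : 0 < η')
    (hK : 0 ≤ K) (hf : DyadicCellBound η η' K f) : RectHolderOn dyadics η η' f := by
  intro L
  set M := max L 1 with hM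
  have hM1 : 1 ≤ M := le_max_right _ _
  have hC := dyadicConst_nonneg hη hM1
  have hC' := dyadicConst_nonneg hη' hM1
  refine ⟨dyadicConst η' M * (dyadicConst η M * K), by positivity,
    fun s₁ hs₁ s₂ hs₂ t₁ ht₁ t₂ ht₂ hs ht => ?_⟩
  have hs' := hs.trans (le_max_left L 1)
  have ht' := ht.trans (le_max_left L 1)
  have h1 : ∀ (m : ℕ) (j : ℤ),
      |(f (s₂, ((j : ℝ) + 1) / 2 ^ m) - f (s₁, ((j : ℝ) + 1) / 2 ^ m)) -
        (f (s₂, j / 2 ^ m) - f (s₁, j / 2 ^ m))| ≤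
      (dyadicConst η M * K * |s₂ - s₁| ^ η) * ((1 / 2 : ℝ) ^ η') ^ m := by
    intro m j
    have h := abs_sub_le_of_dyadic (f := fun s => f (s, ((j : ℝ) + 1) / 2 ^ m) - f (s, j / 2 ^ m))
      (K := K * ((1 / 2 : ℝ) ^ η') ^ m) hη (by positivity) (fun n i => ?_) hM1 hs₁ hs₂ hs'
    · calc _ = _ := by congr 1; ring
        _ ≤ _ := h
        _ = _ := by ring
    · have := hf n m i j
      rw [rectIncr] at this
      calc _ = _ := by congr 1; ring
        _ ≤ _ := this
        _ = _ := by ring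
  have h2 := abs_sub_le_of_dyadic (f := fun t => f (s₂, t) - f (s₁, t)) hη' (by positivity) h1 hM1
    ht₁ ht₂ ht'
  calc |rectIncr f s₁ s₂ t₁ t₂| = _ := by rw [rectIncr]; congr 1; ring
    _ ≤ _ := h2
    _ = _ := by ring

/-- A function vanishing on the axes is recovered from its increments: move s' to s over [0,t], then
t' to t over [0,s']. -/
lemma RectHolderOn.abs_sub_le {S : Set ℝ} {η η' : ℝ} {f : ℝ × ℝ → ℝ} (hf : RectHolderOn S η η' f)
    (hη : 0 < η) (hη' : 0 < η') (hS : (0 : ℝ) ∈ S) (h0 : ∀ t, f (0, t) = 0)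
    (h0' : ∀ s, f (s, 0) = 0) (L : ℝ) :
    ∃ B, ∀ s ∈ S, ∀ t ∈ S, ∀ s' ∈ S, ∀ t' ∈ S, |s| ≤ L → |t| ≤ L → |s'| ≤ L → |t'| ≤ L →
      |f (s, t) - f (s', t')| ≤ B * (|s - s'| ^ η + |t - t'| ^ η') := by
  obtain ⟨B, hB0, hB⟩ := hf (2 * L)
  refine ⟨B * (L ^ η + L ^ η'), fun s hs t ht s' hs' t' ht' hsL htL hsL' htL' => ?_⟩
  have hL : 0 ≤ L := (abs_nonneg s).trans hsL
  have hd : ∀ a b : ℝ, |a| ≤ L → |b| ≤ L → |a - b| ≤ 2 * L := fun a b ha hb =>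
    (abs_sub _ _).trans (by linarith)
  have h1 := hB s' hs' s hs 0 hS t ht (hd _ _ hsL hsL') (by simpa using by linarith)
  have h2 := hB 0 hS s' hs' t' ht' t ht (by simpa using by linarith) (hd _ _ htL htL')
  simp only [rectIncr, h0, h0', sub_zero, add_zero] at h1 h2
  have h3 : |t| ^ η' ≤ L ^ η' := Real.rpow_le_rpow (abs_nonneg _) htL hη'.le
  have h4 : |s'| ^ η ≤ L ^ η := Real.rpow_le_rpow (abs_nonneg _) hsL' hη.le
  have h5 : 0 ≤ L ^ η' := by positivity
  have h6 : 0 ≤ L ^ η := by positivity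
  calc |f (s, t) - f (s', t')| ≤ |f (s, t) - f (s', t)| + |f (s', t) - f (s', t')| :=
        _root_.abs_sub_le _ _ _
    _ ≤ B * (|s - s'| ^ η * |t| ^ η') + B * (|s'| ^ η * |t - t'| ^ η') := add_le_add h1 h2
    _ ≤ B * (|s - s'| ^ η * L ^ η') + B * (L ^ η * |t - t'| ^ η') := by gcongr
    _ ≤ B * (|s - s'| ^ η * L ^ η') + B * (L ^ η * |t - t'| ^ η') +
        (B * (|s - s'| ^ η * L ^ η) + B * (L ^ η' * |t - t'| ^ η')) :=
        le_add_of_nonneg_right (by positivity)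
    _ = _ := by ring

lemma RectHolderOn.continuous {η η' : ℝ} {f : ℝ × ℝ → ℝ} (hf : RectHolderOn univ η η' f)
    (hη : 0 < η) (hη' : 0 < η') (h0 : ∀ t, f (0, t) = 0) (h0' : ∀ s, f (s, 0) = 0) :
    Continuous f := by
  rw [continuous_iff_continuousAt]
  rintro ⟨s', t'⟩
  obtain ⟨B, hB⟩ := hf.abs_sub_le hη hη' (mem_univ 0) h0 h0' (‖(s', t')‖ + 1)
  have hlim : Tendsto (fun p : ℝ × ℝ => B * (|p.1 - s'| ^ η + |p.2 - t'| ^ η')) (𝓝 (s', t'))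
      (𝓝 0) := by
    have hc : Continuous fun p : ℝ × ℝ => B * (|p.1 - s'| ^ η + |p.2 - t'| ^ η') :=
      continuous_const.mul
        (((continuous_fst.sub continuous_const).abs.rpow_const fun _ => Or.inr hη.le).add
          ((continuous_snd.sub continuous_const).abs.rpow_const fun _ => Or.inr hη'.le))
    have := hc.tendsto (s', t')
    simpa [Real.zero_rpow hη.ne', Real.zero_rpow hη'.ne'] using this
  rw [ContinuousAt, tendsto_iff_norm_sub_tendsto_zero]
  refine tendsto_of_tendsto_of_tendsto_of_le_of_le' tendsto_const_nhds hlim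
    (Eventually.of_forall fun _ => norm_nonneg _) ?_
  filter_upwards [Metric.ball_mem_nhds (s', t') one_pos] with p hp
  have hp1 : ‖p‖ ≤ ‖(s', t')‖ + 1 := by
    have := norm_le_norm_add_norm_sub' p (s', t')
    rw [mem_ball_iff_norm] at hp
    linarith
  have hp2 : ‖(s', t')‖ ≤ ‖(s', t')‖ + 1 := by linarith
  exact hB p.1 trivial p.2 trivial s' trivial t' trivial ((norm_fst_le p).trans hp1)
    ((norm_snd_le p).trans hp1) ((norm_fst_le (s', t')).trans hp2)
    ((norm_snd_le (s', t')).trans hp2)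

/-- The limit of `f` along dyadic approximations from below. -/
def dyadicLim (f : ℝ × ℝ → ℝ) (p : ℝ × ℝ) : ℝ :=
  limUnder atTop fun n : ℕ => f (dyadicFloor n p.1, dyadicFloor n p.2)

lemma RectHolderOn.tendsto_dyadicLim {η η' : ℝ} {f : ℝ × ℝ → ℝ}
    (hf : RectHolderOn dyadics η η' f) (hη : 0 < η) (hη' : 0 < η') (h0 : ∀ t, f (0, t) = 0)
    (h0' : ∀ s, f (s, 0) = 0) (p : ℝ × ℝ) :
    Tendsto (fun n : ℕ => f (dyadicFloor n p.1, dyadicFloor n p.2)) atTop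
      (𝓝 (dyadicLim f p)) := by
  obtain ⟨B, hB⟩ := hf.abs_sub_le hη hη' zero_mem_dyadics h0 h0' (‖p‖ + 1)
  have hbd : ∀ s n, |s| ≤ ‖p‖ → |dyadicFloor n s| ≤ ‖p‖ + 1 := by
    intro s n hs
    have h1 := abs_dyadicFloor_sub_le n s
    have h2 := abs_sub_abs_le_abs_sub (dyadicFloor n s) s
    linarith
  refine tendsto_nhds_limUnder (cauchySeq_tendsto_of_complete ?_)
  rw [cauchySeq_iff_tendsto_dist_atTop_0]
  have hone : ∀ (s θ : ℝ), 0 < θ → Tendsto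
      (fun n : ℕ × ℕ => |dyadicFloor n.1 s - dyadicFloor n.2 s| ^ θ) atTop (𝓝 0) := by
    intro s θ hθ
    rw [← prod_atTop_atTop_eq]
    have h := (((tendsto_dyadicFloor s).comp tendsto_fst).sub
      ((tendsto_dyadicFloor s).comp (tendsto_snd (f := (atTop : Filter ℕ))))).abs.rpow_const
        (p := θ) (Or.inr hθ.le)
    simpa [Real.zero_rpow hθ.ne'] using h
  have hlim := ((hone p.1 η hη).add (hone p.2 η' hη')).const_mul B
  simp only [add_zero, mul_zero] at hlim
  refine tendsto_of_tendsto_of_tendsto_of_le_of_le tendsto_const_nhds hlim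
    (fun _ => dist_nonneg) fun n => ?_
  exact hB _ (dyadicFloor_mem _ _) _ (dyadicFloor_mem _ _) _ (dyadicFloor_mem _ _) _
    (dyadicFloor_mem _ _) (hbd _ _ (norm_fst_le p)) (hbd _ _ (norm_snd_le p))
    (hbd _ _ (norm_fst_le p)) (hbd _ _ (norm_snd_le p))

lemma RectHolderOn.dyadicLim {η η' : ℝ} {f : ℝ × ℝ → ℝ} (hf : RectHolderOn dyadics η η' f)
    (hη : 0 < η) (hη' : 0 < η') (h0 : ∀ t, f (0, t) = 0) (h0' : ∀ s, f (s, 0) = 0) :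
    RectHolderOn univ η η' (dyadicLim f) := by
  intro L
  -- Each of the two endpoints moves by at most 1 under `dyadicFloor`.
  obtain ⟨B, hB0, hB⟩ := hf (L + 2)
  refine ⟨B, hB0, fun s₁ _ s₂ _ t₁ _ t₂ _ hs ht => ?_⟩
  have hlim := fun s t => hf.tendsto_dyadicLim hη hη' h0 h0' (s, t)
  have h1 : Tendsto (fun n => |rectIncr f (dyadicFloor n s₁) (dyadicFloor n s₂)
      (dyadicFloor n t₁) (dyadicFloor n t₂)|) atTop
      (𝓝 |rectIncr (FracNoise.dyadicLim f) s₁ s₂ t₁ t₂|) :=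
    ((((hlim s₂ t₂).sub (hlim s₂ t₁)).sub (hlim s₁ t₂)).add (hlim s₁ t₁)).abs
  have hone : ∀ (a b θ : ℝ), 0 < θ → Tendsto
      (fun n : ℕ => |dyadicFloor n b - dyadicFloor n a| ^ θ) atTop (𝓝 (|b - a| ^ θ)) :=
    fun a b θ hθ =>
      ((tendsto_dyadicFloor b).sub (tendsto_dyadicFloor a)).abs.rpow_const (Or.inr hθ.le)
  have hbd : ∀ a b n, |b - a| ≤ L → |dyadicFloor n b - dyadicFloor n a| ≤ L + 2 := by
    intro a b n hab
    have ha := abs_le.1 (abs_dyadicFloor_sub_le n a)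
    have hb := abs_le.1 (abs_dyadicFloor_sub_le n b)
    have hab := abs_le.1 hab
    rw [abs_le]
    constructor <;> linarith [ha.1, ha.2, hb.1, hb.2, hab.1, hab.2]
  exact le_of_tendsto_of_tendsto' h1 (((hone _ _ η hη).mul (hone _ _ η' hη')).const_mul B)
    fun n => hB _ (dyadicFloor_mem _ _) _ (dyadicFloor_mem _ _) _ (dyadicFloor_mem _ _) _
      (dyadicFloor_mem _ _) (hbd _ _ n hs) (hbd _ _ n ht)

lemma dyadicLim_zero_left {f : ℝ × ℝ → ℝ} (h0 : ∀ t, f (0, t) = 0) (t : ℝ) :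
    dyadicLim f (0, t) = 0 := by
  simp only [dyadicLim, dyadicFloor_zero, h0]
  exact tendsto_const_nhds.limUnder_eq

lemma dyadicLim_zero_right {f : ℝ × ℝ → ℝ} (h0 : ∀ s, f (s, 0) = 0) (s : ℝ) :
    dyadicLim f (s, 0) = 0 := by
  simp only [dyadicLim, dyadicFloor_zero, h0]
  exact tendsto_const_nhds.limUnder_eq

/-! ### Changing signs on the quadrants -/

lemma abs_sign_le_one (s : ℝ) : |Real.sign s| ≤ 1 := by
  rcases Real.sign_apply_eq s with h | h | h <;> simp [h]

/-- If s and t lie strictly on the same side of 0, the sign is a common factor. Otherwise both are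
within |t - s| of 0, where g vanishes, and each is compared with 0. -/
lemma abs_sign_mul_sub_le {g : ℝ → ℝ} {K η L s t : ℝ} (hη : 0 < η) (hK : 0 ≤ K) (h0 : g 0 = 0)
    (hg : ∀ a b, |b - a| ≤ L → |g b - g a| ≤ K * |b - a| ^ η) (hst : |t - s| ≤ L) :
    |Real.sign t * g t - Real.sign s * g s| ≤ 2 * K * |t - s| ^ η := by
  have key : |s| ≤ |t - s| → |t| ≤ |t - s| →
      |Real.sign t * g t - Real.sign s * g s| ≤ 2 * K * |t - s| ^ η := by
    intro hs ht
    have h1 := hg 0 s (by simpa using hs.trans hst)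
    have h2 := hg 0 t (by simpa using ht.trans hst)
    simp only [h0, sub_zero] at h1 h2
    have h3 : |s| ^ η ≤ |t - s| ^ η := Real.rpow_le_rpow (abs_nonneg _) hs hη.le
    have h4 : |t| ^ η ≤ |t - s| ^ η := Real.rpow_le_rpow (abs_nonneg _) ht hη.le
    calc _ ≤ |Real.sign t * g t| + |Real.sign s * g s| := abs_sub _ _
      _ ≤ |g t| + |g s| := by
          rw [abs_mul, abs_mul]
          exact add_le_add (mul_le_of_le_one_left (abs_nonneg _) (abs_sign_le_one t))
            (mul_le_of_le_one_left (abs_nonneg _) (abs_sign_le_one s))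
      _ ≤ K * |t - s| ^ η + K * |t - s| ^ η :=
          add_le_add (h2.trans (by gcongr)) (h1.trans (by gcongr))
      _ = _ := by ring
  have same : |g t - g s| ≤ 2 * K * |t - s| ^ η := by
    refine (hg s t hst).trans ?_
    have : 0 ≤ K * |t - s| ^ η := by positivity
    linarith
  rcases lt_trichotomy s 0 with hs | rfl | hs
  · rcases lt_or_ge t 0 with ht | ht
    · rw [Real.sign_of_neg hs, Real.sign_of_neg ht]
      calc _ = |g t - g s| := by rw [← abs_neg]; congr 1; ring
        _ ≤ _ := same
    · refine key ?_ ?_ <;>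
      · rw [abs_of_nonneg (by linarith : 0 ≤ t - s)]
        rw [abs_le]; constructor <;> linarith
  · exact key (by simp) (by simp)
  · rcases lt_or_ge 0 t with ht | ht
    · rw [Real.sign_of_pos hs, Real.sign_of_pos ht, one_mul, one_mul]
      exact same
    · refine key ?_ ?_ <;>
      · rw [abs_of_nonpos (by linarith : t - s ≤ 0)]
        rw [abs_le]; constructor <;> linarith

/-- Multiplication by the signs of the two coordinates. -/
def signTwist (f : ℝ × ℝ → ℝ) (p : ℝ × ℝ) : ℝ := Real.sign p.1 * Real.sign p.2 * f p

lemma RectHolderOn.signTwist {η η' : ℝ} {f : ℝ × ℝ → ℝ} (hf : RectHolderOn univ η η' f)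
    (hη : 0 < η) (hη' : 0 < η') (h0 : ∀ t, f (0, t) = 0) (h0' : ∀ s, f (s, 0) = 0) :
    RectHolderOn univ η η' (signTwist f) := by
  intro L
  obtain ⟨B, hB0, hB⟩ := hf L
  refine ⟨2 * (2 * B), by positivity, fun s₁ _ s₂ _ t₁ _ t₂ _ hs ht => ?_⟩
  have h1 : ∀ a b, |b - a| ≤ L → |(Real.sign s₂ * f (s₂, b) - Real.sign s₁ * f (s₁, b)) -
      (Real.sign s₂ * f (s₂, a) - Real.sign s₁ * f (s₁, a))| ≤
      2 * B * |s₂ - s₁| ^ η * |b - a| ^ η' := by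
    intro a b hab
    have h := abs_sign_mul_sub_le (g := fun s => f (s, b) - f (s, a)) (K := B * |b - a| ^ η')
      (s := s₁) (t := s₂) hη (by positivity) (by simp [h0]) (fun x y hxy => ?_) hs
    · calc _ = _ := by congr 1; ring
        _ ≤ _ := h
        _ = _ := by ring
    · calc _ = |rectIncr f x y a b| := by rw [rectIncr]; congr 1; ring
        _ ≤ _ := hB x trivial y trivial a trivial b trivial hxy hab
        _ = _ := by ring
  have h2 := abs_sign_mul_sub_le
    (g := fun t => Real.sign s₂ * f (s₂, t) - Real.sign s₁ * f (s₁, t)) (s := t₁) (t := t₂) hη'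
    (by positivity) (by simp [h0']) h1 ht
  calc _ = _ := by rw [rectIncr]; simp only [FracNoise.signTwist]; congr 1; ring
    _ ≤ _ := h2
    _ = _ := by ring

lemma RectHolderOn.memRectHolder {η η' : ℝ} {f : ℝ × ℝ → ℝ} (hf : RectHolderOn univ η η' f)
    (hη : 0 < η) (hη' : 0 < η') (h0 : ∀ t, f (0, t) = 0) (h0' : ∀ s, f (s, 0) = 0)
    {D : Set (ℝ × ℝ)} (hD : Bornology.IsBounded D) : MemRectHolder D η η' f := by
  refine ⟨(hf.continuous hη hη' h0 h0').continuousOn, ?_⟩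
  obtain ⟨B, hB0, hB⟩ := hf (Metric.diam D)
  refine lt_of_le_of_lt ?_ (ENNReal.ofReal_lt_top (r := B))
  simp only [rectHolderNorm, iSup_le_iff]
  intro s₁ s₂ t₁ t₂ hs ht hsub
  refine ENNReal.ofReal_le_ofReal ?_
  have hs' : 0 < |s₂ - s₁| := abs_pos.2 (sub_pos.2 hs).ne'
  have ht' : 0 < |t₂ - t₁| := abs_pos.2 (sub_pos.2 ht).ne'
  rw [div_le_iff₀ (by positivity)]
  have hdiam := Metric.dist_le_diam_of_mem hD (hsub (⟨⟨hs.le, le_rfl⟩, ⟨ht.le, le_rfl⟩⟩ :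
    (s₂, t₂) ∈ Icc s₁ s₂ ×ˢ Icc t₁ t₂)) (hsub (⟨⟨le_rfl, hs.le⟩, ⟨le_rfl, ht.le⟩⟩ :
    (s₁, t₁) ∈ Icc s₁ s₂ ×ˢ Icc t₁ t₂))
  rw [Prod.dist_eq, max_le_iff, Real.dist_eq, Real.dist_eq] at hdiam
  exact hB s₁ trivial s₂ trivial t₁ trivial t₂ trivial hdiam.1 hdiam.2

/-! ### Moment bounds imply dyadic bounds -/

/-- With δ = 2^{-n} the left side is δ^{2k(γ-η)}. A large moment order makes it at most 4^{-n},
which beats the growth 2^n of the number of cells. -/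
lemma dyadic_weight_le {γ η : ℝ} {k : ℕ} (hk : 2 ≤ 2 * k * (γ - η)) (n : ℕ) :
    ((((1 / 2 : ℝ) ^ η) ^ n)⁻¹) ^ (2 * k) * (((1 / 2 : ℝ) ^ n) ^ (2 * γ)) ^ k ≤
      ((1 / 2 : ℝ) ^ n) ^ 2 := by
  have hδ : 0 < (1 / 2 : ℝ) ^ n := by positivity
  set δ := (1 / 2 : ℝ) ^ n with hδ'
  have h1 : ((1 / 2 : ℝ) ^ η) ^ n = δ ^ η := by
    rw [hδ', ← Real.rpow_natCast, ← Real.rpow_natCast, ← Real.rpow_mul (by norm_num),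
      ← Real.rpow_mul (by norm_num), mul_comm]
  rw [h1, ← Real.rpow_neg hδ.le, ← Real.rpow_natCast, ← Real.rpow_mul hδ.le, ← Real.rpow_natCast,
    ← Real.rpow_mul hδ.le, ← Real.rpow_add hδ, ← Real.rpow_natCast]
  refine Real.rpow_le_rpow_of_exponent_ge hδ (pow_le_one₀ (by norm_num) (by norm_num)) ?_
  push_cast
  linarith

lemma le_one_add_of_pow_le {x S : ℝ} {k : ℕ} (hx : 0 ≤ x) (hk : k ≠ 0) (h : x ^ k ≤ S) :
    x ≤ 1 + S := by
  rcases le_total x 1 with h1 | h1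
  · have : 0 ≤ S := (pow_nonneg hx k).trans h
    linarith
  · linarith [le_self_pow₀ h1 hk]

/-- The increment of the process `W` on a dyadic cell. -/
def cellIncr {Ω : Type*} (W : ℝ × ℝ → Ω → ℝ) (n m : ℕ) (i j : ℤ) (ω : Ω) : ℝ :=
  rectIncr (fun p => W p ω) (i / 2 ^ n) (((i : ℝ) + 1) / 2 ^ n) (j / 2 ^ m)
    (((j : ℝ) + 1) / 2 ^ m)

/-- The weighted sum of the `2k`-th powers of the dyadic increments in a square. -/
def cellSum {Ω : Type*} (W : ℝ × ℝ → Ω → ℝ) (N k : ℕ) (η η' : ℝ) (ω : Ω) : ℝ≥0∞ :=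
  ∑' n : ℕ, ∑' m : ℕ, ∑ i ∈ Finset.Ico (-(N * 2 ^ n) : ℤ) (N * 2 ^ n),
    ∑ j ∈ Finset.Ico (-(N * 2 ^ m) : ℤ) (N * 2 ^ m),
      ENNReal.ofReal ((((1 / 2 : ℝ) ^ η) ^ n)⁻¹ * (((1 / 2 : ℝ) ^ η') ^ m)⁻¹) ^ (2 * k) *
        ‖cellIncr W n m i j ω‖ₑ ^ (2 * k)

section Kolmogorov

variable {Ω : Type*} [MeasurableSpace Ω] {P : Measure Ω} {W : ℝ × ℝ → Ω → ℝ}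
  {γ γ' η η' : ℝ} {k N : ℕ} {C : ℝ≥0∞}

lemma aemeasurable_cellIncr (hW : ∀ p, AEMeasurable (W p) P) (n m : ℕ) (i j : ℤ) :
    AEMeasurable (cellIncr W n m i j) P :=
  (((hW _).sub (hW _)).sub (hW _)).add (hW _)

lemma lintegral_cellSum_term_le (hk : 2 ≤ 2 * k * (γ - η)) (hk' : 2 ≤ 2 * k * (γ' - η'))
    (hmom : ∀ s₁ s₂ t₁ t₂, s₁ ≤ s₂ → t₁ ≤ t₂ →
      ∫⁻ ω, ‖rectIncr (fun p => W p ω) s₁ s₂ t₁ t₂‖ₑ ^ (2 * k) ∂P ≤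
        C * ENNReal.ofReal ((s₂ - s₁) ^ (2 * γ) * (t₂ - t₁) ^ (2 * γ')) ^ k)
    (n m : ℕ) (i j : ℤ) :
    ENNReal.ofReal ((((1 / 2 : ℝ) ^ η) ^ n)⁻¹ * (((1 / 2 : ℝ) ^ η') ^ m)⁻¹) ^ (2 * k) *
      ∫⁻ ω, ‖cellIncr W n m i j ω‖ₑ ^ (2 * k) ∂P ≤
        C * (ENNReal.ofReal (((1 / 2 : ℝ) ^ n) ^ 2) * ENNReal.ofReal (((1 / 2 : ℝ) ^ m) ^ 2)) := by
  have hlen : ∀ (n : ℕ) (i : ℤ), ((i : ℝ) + 1) / 2 ^ n - i / 2 ^ n = (1 / 2) ^ n := by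
    intro n i; rw [← sub_div, add_sub_cancel_left, one_div_pow]
  have hle : ∀ (n : ℕ) (i : ℤ), (i : ℝ) / 2 ^ n ≤ ((i : ℝ) + 1) / 2 ^ n := by
    intro n i; gcongr; linarith
  have h := hmom _ _ _ _ (hle n i) (hle m j)
  rw [hlen, hlen] at h
  calc _ ≤ ENNReal.ofReal ((((1 / 2 : ℝ) ^ η) ^ n)⁻¹ * (((1 / 2 : ℝ) ^ η') ^ m)⁻¹) ^ (2 * k) *
        (C * ENNReal.ofReal (((1 / 2 : ℝ) ^ n) ^ (2 * γ) * ((1 / 2 : ℝ) ^ m) ^ (2 * γ')) ^ k) := by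
        gcongr; exact h
    _ = C * ENNReal.ofReal
        (((((1 / 2 : ℝ) ^ η) ^ n)⁻¹ ^ (2 * k) * (((1 / 2 : ℝ) ^ n) ^ (2 * γ)) ^ k) *
          ((((1 / 2 : ℝ) ^ η') ^ m)⁻¹ ^ (2 * k) * (((1 / 2 : ℝ) ^ m) ^ (2 * γ')) ^ k)) := by
        rw [← ENNReal.ofReal_pow (by positivity), ← ENNReal.ofReal_pow (by positivity),
          mul_left_comm, ← ENNReal.ofReal_mul (by positivity)]
        congr 2
        ring
    _ ≤ C * ENNReal.ofReal (((1 / 2 : ℝ) ^ n) ^ 2 * ((1 / 2 : ℝ) ^ m) ^ 2) := by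
        gcongr C * ENNReal.ofReal (?_ * ?_)
        · exact dyadic_weight_le hk n
        · exact dyadic_weight_le hk' m
    _ = _ := by rw [ENNReal.ofReal_mul (by positivity)]

lemma lintegral_cellSum_lt_top (hW : ∀ p, AEMeasurable (W p) P) (hC : C < ⊤)
    (hk : 2 ≤ 2 * k * (γ - η)) (hk' : 2 ≤ 2 * k * (γ' - η'))
    (hmom : ∀ s₁ s₂ t₁ t₂, s₁ ≤ s₂ → t₁ ≤ t₂ →
      ∫⁻ ω, ‖rectIncr (fun p => W p ω) s₁ s₂ t₁ t₂‖ₑ ^ (2 * k) ∂P ≤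
        C * ENNReal.ofReal ((s₂ - s₁) ^ (2 * γ) * (t₂ - t₁) ^ (2 * γ')) ^ k) :
    ∫⁻ ω, cellSum W N k η η' ω ∂P < ⊤ := by
  have hcell := fun n m i j => (aemeasurable_cellIncr hW n m i j).enorm.pow_const (2 * k)
  -- There are 2N·2^n intervals at level n, so the factor 4^{-n} leaves a summable 2^{-n},
  -- independently in each direction.
  have hcard : ∀ n : ℕ, ((Finset.Ico (-(N * 2 ^ n) : ℤ) (N * 2 ^ n)).card : ℝ≥0∞) *
      ENNReal.ofReal (((1 / 2 : ℝ) ^ n) ^ 2) = (2 * N) * ENNReal.ofReal ((1 / 2 : ℝ) ^ n) := by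
    intro n
    have h1 : (Finset.Ico (-(N * 2 ^ n) : ℤ) (N * 2 ^ n)).card = 2 * N * 2 ^ n := by
      rw [Int.card_Ico]
      zify
      have h0 : (0 : ℤ) ≤ N * 2 ^ n := by positivity
      rw [Int.toNat_of_nonneg (by linarith)]
      ring
    have h2 : ((2 * N * 2 ^ n : ℕ) : ℝ≥0∞) = ENNReal.ofReal (2 * N * 2 ^ n) := by
      rw [← ENNReal.ofReal_natCast]; push_cast; rfl
    have h3 : (2 * N : ℝ≥0∞) = ENNReal.ofReal (2 * N) := by
      rw [ENNReal.ofReal_mul (by norm_num)]; simp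
    rw [h1, h2, h3, ← ENNReal.ofReal_mul (by positivity), ← ENNReal.ofReal_mul (by positivity)]
    congr 1
    rw [one_div_pow]
    field_simp
  have hsum : ∑' n : ℕ, ENNReal.ofReal ((1 / 2 : ℝ) ^ n) < ⊤ :=
    (summable_geometric_of_lt_one (by norm_num) (by norm_num)).tsum_ofReal_lt_top
  calc ∫⁻ ω, cellSum W N k η η' ω ∂P
      = ∑' n : ℕ, ∑' m : ℕ, ∑ i ∈ Finset.Ico (-(N * 2 ^ n) : ℤ) (N * 2 ^ n),
        ∑ j ∈ Finset.Ico (-(N * 2 ^ m) : ℤ) (N * 2 ^ m),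
          ENNReal.ofReal ((((1 / 2 : ℝ) ^ η) ^ n)⁻¹ * (((1 / 2 : ℝ) ^ η') ^ m)⁻¹) ^ (2 * k) *
            ∫⁻ ω, ‖cellIncr W n m i j ω‖ₑ ^ (2 * k) ∂P := by
        simp only [cellSum]
        rw [lintegral_tsum fun n => by fun_prop]
        congr 1 with n
        rw [lintegral_tsum fun m => by fun_prop]
        congr 1 with m
        rw [lintegral_finsetSum' _ fun i _ => by fun_prop]
        congr 1 with i
        rw [lintegral_finsetSum' _ fun j _ => by fun_prop]
        congr 1 with j
        rw [lintegral_const_mul'' _ (hcell n m i j)]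
    _ ≤ ∑' n : ℕ, ∑' m : ℕ, ∑ i ∈ Finset.Ico (-(N * 2 ^ n) : ℤ) (N * 2 ^ n),
        ∑ j ∈ Finset.Ico (-(N * 2 ^ m) : ℤ) (N * 2 ^ m),
          C * (ENNReal.ofReal (((1 / 2 : ℝ) ^ n) ^ 2) *
            ENNReal.ofReal (((1 / 2 : ℝ) ^ m) ^ 2)) := by
        gcongr ∑' n, ∑' m, ∑ i ∈ _, ∑ j ∈ _, ?_ with n m i _ j _
        exact lintegral_cellSum_term_le hk hk' hmom n m i j
    _ = ∑' n : ℕ, ∑' m : ℕ, C * (((2 * N) * ENNReal.ofReal ((1 / 2 : ℝ) ^ n)) *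
          ((2 * N) * ENNReal.ofReal ((1 / 2 : ℝ) ^ m))) := by
        congr 1 with n
        congr 1 with m
        rw [← hcard n, ← hcard m]
        simp only [Finset.sum_const, nsmul_eq_mul]
        ring
    _ = C * (((2 * N) * ∑' n : ℕ, ENNReal.ofReal ((1 / 2 : ℝ) ^ n)) *
          ((2 * N) * ∑' n : ℕ, ENNReal.ofReal ((1 / 2 : ℝ) ^ n))) := by
        simp only [ENNReal.tsum_mul_left, ENNReal.tsum_mul_right]
    _ < ⊤ := by
        have h2N : (2 * N : ℝ≥0∞) < ⊤ := ENNReal.mul_lt_top (by simp) (by simp)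
        exact ENNReal.mul_lt_top hC
          (ENNReal.mul_lt_top (ENNReal.mul_lt_top h2N hsum) (ENNReal.mul_lt_top h2N hsum))

/-- A two-parameter Kolmogorov estimate on dyadic cells. -/
lemma ae_exists_dyadicCellBound (hW : ∀ p, AEMeasurable (W p) P) (hC : C < ⊤) (hk0 : k ≠ 0)
    (hk : 2 ≤ 2 * k * (γ - η)) (hk' : 2 ≤ 2 * k * (γ' - η'))
    (hmom : ∀ s₁ s₂ t₁ t₂, s₁ ≤ s₂ → t₁ ≤ t₂ →
      ∫⁻ ω, ‖rectIncr (fun p => W p ω) s₁ s₂ t₁ t₂‖ₑ ^ (2 * k) ∂P ≤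
        C * ENNReal.ofReal ((s₂ - s₁) ^ (2 * γ) * (t₂ - t₁) ^ (2 * γ')) ^ k)
    (hout : ∀ s₁ s₂ t₁ t₂ : ℝ, s₁ ≤ s₂ → t₁ ≤ t₂ →
      (s₂ ≤ -N ∨ (N : ℝ) ≤ s₁ ∨ t₂ ≤ -N ∨ (N : ℝ) ≤ t₁) →
      ∀ᵐ ω ∂P, rectIncr (fun p => W p ω) s₁ s₂ t₁ t₂ = 0) :
    ∀ᵐ ω ∂P, ∃ K, 0 ≤ K ∧ DyadicCellBound η η' K (fun p => W p ω) := by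
  have hfin : ∀ᵐ ω ∂P, cellSum W N k η η' ω < ⊤ := by
    refine ae_lt_top' ?_ (lintegral_cellSum_lt_top hW hC hk hk' hmom).ne
    have hcell := fun n m i j => (aemeasurable_cellIncr hW n m i j).enorm.pow_const (2 * k)
    unfold cellSum
    fun_prop
  have hle : ∀ (n : ℕ) (i : ℤ), (i : ℝ) / 2 ^ n ≤ ((i : ℝ) + 1) / 2 ^ n := by
    intro n i; gcongr; linarith
  -- `cellSum` only sees cells inside [-N,N]². The others are countably many and have null
  -- increments.
  have hcells : ∀ᵐ ω ∂P, ∀ (n m : ℕ) (i j : ℤ),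
      (i ∉ Finset.Ico (-(N * 2 ^ n) : ℤ) (N * 2 ^ n) ∨
        j ∉ Finset.Ico (-(N * 2 ^ m) : ℤ) (N * 2 ^ m)) → cellIncr W n m i j ω = 0 := by
    have hout1 : ∀ (n : ℕ) (i : ℤ), i ∉ Finset.Ico (-(N * 2 ^ n) : ℤ) (N * 2 ^ n) →
        ((i : ℝ) + 1) / 2 ^ n ≤ -N ∨ (N : ℝ) ≤ i / 2 ^ n := by
      intro n i hi
      rw [Finset.mem_Ico, not_and_or, not_le, not_lt] at hi
      rcases hi with h | h
      · left
        rw [div_le_iff₀ (by positivity), neg_mul]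
        exact_mod_cast h
      · right
        rw [le_div_iff₀ (by positivity)]
        exact_mod_cast h
    simp only [ae_all_iff]
    intro n m i j hij
    refine hout _ _ _ _ (hle n i) (hle m j) ?_
    rcases hij with h | h
    · rcases hout1 n i h with h | h <;> tauto
    · rcases hout1 m j h with h | h <;> tauto
  filter_upwards [hfin, hcells] with ω hω hzero
  -- Every weighted power is dominated by the whole sum; the added 1 avoids taking 2k-th roots.
  refine ⟨1 + (cellSum W N k η η' ω).toReal, by positivity, fun n m i j => ?_⟩
  change |cellIncr W n m i j ω| ≤ _
  by_cases hij : i ∉ Finset.Ico (-(N * 2 ^ n) : ℤ) (N * 2 ^ n) ∨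
      j ∉ Finset.Ico (-(N * 2 ^ m) : ℤ) (N * 2 ^ m)
  · rw [hzero n m i j hij, abs_zero]; positivity
  push Not at hij
  set w := (((1 / 2 : ℝ) ^ η) ^ n)⁻¹ * (((1 / 2 : ℝ) ^ η') ^ m)⁻¹ with hw
  have hw0 : 0 < w := by positivity
  have hterm : ENNReal.ofReal w ^ (2 * k) * ‖cellIncr W n m i j ω‖ₑ ^ (2 * k) ≤
      cellSum W N k η η' ω := by
    refine le_trans ?_ (ENNReal.le_tsum n)
    refine le_trans ?_ (ENNReal.le_tsum m)
    refine le_trans ?_ (Finset.single_le_sum (fun _ _ => zero_le) hij.1)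
    exact Finset.single_le_sum (f := fun j => ENNReal.ofReal w ^ (2 * k) *
      ‖cellIncr W n m i j ω‖ₑ ^ (2 * k)) (fun _ _ => zero_le) hij.2
  have hreal : (w * |cellIncr W n m i j ω|) ^ (2 * k) ≤ (cellSum W N k η η' ω).toReal := by
    rw [← ENNReal.ofReal_le_iff_le_toReal hω.ne, ENNReal.ofReal_pow (by positivity),
      ENNReal.ofReal_mul hw0.le, mul_pow, ← Real.enorm_eq_ofReal_abs]
    exact hterm
  have h := le_one_add_of_pow_le (by positivity) (by omega) hreal
  rw [← le_div_iff₀' hw0] at h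
  refine h.trans_eq ?_
  rw [hw, ← mul_inv, div_inv_eq_mul]

end Kolmogorov

/-! ### The process of corner rectangles -/

lemma hasCovMeasure_rotatedNoise {Ω : Type*} [MeasurableSpace Ω] {P : Measure Ω}
    {H ν T : ℝ} (R₁ R₂ : ℝ) (hH : H ∈ Ioo (1 / 2 : ℝ) 1) (hν : ν ∈ Ioo (0 : ℝ) 1)
    {X : PlaneTest → Ω → ℝ} (hX : IsFractionalNoise P H ν T X) :
    HasCovMeasure P (rotatedNoise X) (domain R₁ R₂ T) (noiseMeasure H ν (domain R₁ R₂ T)) where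
  gaussian φ := hX.gaussian.hasGaussianLaw_eval (compRot φ)
  centered φ := hX.centered (compRot φ)
  cov φ ψ hφ hψ := by
    rw [← noiseCov_compRot hH hν hφ hψ]
    exact hX.covariance (compRot φ) (compRot ψ)
  finite := isFiniteMeasure_noiseMeasure hH hν (isCompact_domain R₁ R₂ T).measurableSet
    (isCompact_domain R₁ R₂ T).isBounded
  ac := noiseMeasure_absolutelyContinuous H ν _

lemma exists_isApproximating_cornerRect {D : Set (ℝ × ℝ)} (hD : IsCompact D)
    (hconv : Convex ℝ D) (p : ℝ × ℝ) : ∃ φ, IsApproximating D (cornerRect D p) φ :=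
  exists_isApproximating hD inter_subset_right
    ((isCompact_uIcc.prod isCompact_uIcc).isClosed.inter hD.isClosed)
    (((convex_uIcc _ _).prod (convex_uIcc _ _)).inter hconv)

lemma HasCovMeasure.exists_isRotatedNoiseOfSet {Ω : Type*} [MeasurableSpace Ω] {P : Measure Ω}
    {X : PlaneTest → Ω → ℝ} {D A : Set (ℝ × ℝ)} {m : Measure ((ℝ × ℝ) × (ℝ × ℝ))}
    (hY : HasCovMeasure P (rotatedNoise X) D m) (hA : ∃ φ, IsApproximating D A φ) :
    ∃ ξ, IsRotatedNoiseOfSet P X D A ξ := by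
  obtain ⟨φ, hφ⟩ := hA
  obtain ⟨ξ, hξ, hlim⟩ := hY.exists_tendsto_eLpNorm hφ.approxFun
  exact ⟨ξ, hξ, ⟨φ, hφ⟩, fun ψ hψ =>
    hY.tendsto_eLpNorm_of_isWienerIntegral ⟨hξ, φ, hφ.approxFun, hlim⟩ hψ.approxFun⟩

/-! ### Signed corner functions -/

/-- The signed indicator function of the interval between `0` and `s`. -/
def stepFun (s x : ℝ) : ℝ := if 0 < x then (if x ≤ s then 1 else 0) else if s < x then -1 else 0

lemma measurable_stepFun (s : ℝ) : Measurable (stepFun s) :=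
  Measurable.ite measurableSet_Ioi
    (Measurable.ite measurableSet_Iic measurable_const measurable_const)
    (Measurable.ite measurableSet_Ioi measurable_const measurable_const)

lemma abs_stepFun_le (s x : ℝ) : |stepFun s x| ≤ 1 := by
  unfold stepFun; split_ifs <;> simp

lemma stepFun_sub {s₁ s₂ : ℝ} (h : s₁ ≤ s₂) (x : ℝ) :
    stepFun s₂ x - stepFun s₁ x = (Ioc s₁ s₂).indicator (fun _ => 1) x := by
  simp only [stepFun, indicator, mem_Ioc]
  split_ifs <;> first | (exfalso; grind) | norm_num

lemma sign_mul_indicator_uIcc {s x : ℝ} (h0 : x ≠ 0) (hs : x ≠ s) :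
    Real.sign s * (uIcc 0 s).indicator (fun _ => 1) x = stepFun s x := by
  simp only [stepFun, indicator]
  rcases lt_trichotomy s 0 with h | rfl | h
  · rw [Real.sign_of_neg h, uIcc_of_ge h.le]
    simp only [mem_Icc]
    split_ifs <;> first | (exfalso; grind) | norm_num
  · rw [Real.sign_zero]
    split_ifs <;> first | (exfalso; grind) | norm_num
  · rw [Real.sign_of_pos h, uIcc_of_le h.le]
    simp only [mem_Icc]
    split_ifs <;> first | (exfalso; grind) | norm_num

/-- The value depends on s only through whether x ≤ s, which dyadic approximation from below
eventually decides correctly. -/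
lemma tendsto_stepFun_dyadicFloor {s x : ℝ} (h : x ≠ s) :
    Tendsto (fun n => stepFun (dyadicFloor n s) x) atTop (𝓝 (stepFun s x)) := by
  refine tendsto_const_nhds.congr' ?_
  have hev : ∀ᶠ n in atTop, (x ≤ s ↔ x ≤ dyadicFloor n s) := by
    rcases h.lt_or_gt with h | h
    · filter_upwards [(tendsto_dyadicFloor s).eventually_const_lt h] with n hn
      exact ⟨fun _ => hn.le, fun _ => h.le⟩
    · refine Eventually.of_forall fun n => ⟨fun h' => absurd h' h.not_ge, fun h' => ?_⟩
      exact h'.trans (dyadicFloor_le n s)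
  filter_upwards [hev] with n hn
  simp only [stepFun, ← hn, ← not_le]

/-- The signed indicator function of the corner rectangle at `p`, within `D`. -/
def cornerFun (D : Set (ℝ × ℝ)) (p x : ℝ × ℝ) : ℝ :=
  stepFun p.1 x.1 * stepFun p.2 x.2 * D.indicator (fun _ => 1) x

lemma measurable_cornerFun {D : Set (ℝ × ℝ)} (hD : MeasurableSet D) (p : ℝ × ℝ) :
    Measurable (cornerFun D p) :=
  (((measurable_stepFun p.1).comp measurable_fst).mul
    ((measurable_stepFun p.2).comp measurable_snd)).mul (measurable_const.indicator hD)

lemma abs_cornerFun_le (D : Set (ℝ × ℝ)) (p x : ℝ × ℝ) : |cornerFun D p x| ≤ 1 := by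
  have h3 : |D.indicator (fun _ => (1 : ℝ)) x| ≤ 1 := by
    by_cases h : x ∈ D <;> simp [h]
  rw [cornerFun, abs_mul, abs_mul]
  exact mul_le_one₀ (mul_le_one₀ (abs_stepFun_le _ _) (abs_nonneg _) (abs_stepFun_le _ _))
    (abs_nonneg _) h3

lemma ae_fst_ne (c : ℝ) : ∀ᵐ x ∂(volume : Measure (ℝ × ℝ)), x.1 ≠ c :=
  (Measure.quasiMeasurePreserving_fst (μ := (volume : Measure ℝ))
    (ν := (volume : Measure ℝ))).ae (p := fun a => a ≠ c)
    (measure_eq_zero_iff_ae_notMem.1 (measure_singleton c))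

lemma ae_snd_ne (c : ℝ) : ∀ᵐ x ∂(volume : Measure (ℝ × ℝ)), x.2 ≠ c :=
  (Measure.quasiMeasurePreserving_snd (μ := (volume : Measure ℝ))
    (ν := (volume : Measure ℝ))).ae (p := fun a => a ≠ c)
    (measure_eq_zero_iff_ae_notMem.1 (measure_singleton c))

lemma indicator_cornerRect (D : Set (ℝ × ℝ)) (p x : ℝ × ℝ) :
    (cornerRect D p).indicator (fun _ => (1 : ℝ)) x =
      (uIcc 0 p.1).indicator (fun _ => 1) x.1 * (uIcc 0 p.2).indicator (fun _ => 1) x.2 *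
        D.indicator (fun _ => 1) x := by
  have h : x ∈ cornerRect D p ↔ (x.1 ∈ uIcc 0 p.1 ∧ x.2 ∈ uIcc 0 p.2) ∧ x ∈ D := Iff.rfl
  by_cases h1 : x.1 ∈ uIcc 0 p.1 <;> by_cases h2 : x.2 ∈ uIcc 0 p.2 <;> by_cases h3 : x ∈ D <;>
    simp [indicator, h, h1, h2, h3]

lemma sign_mul_indicator_cornerRect_ae_eq (D : Set (ℝ × ℝ)) (p : ℝ × ℝ) :
    (fun x => Real.sign p.1 * Real.sign p.2 * (cornerRect D p).indicator (fun _ => 1) x)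
      =ᵐ[volume] cornerFun D p := by
  filter_upwards [ae_fst_ne 0, ae_fst_ne p.1, ae_snd_ne 0, ae_snd_ne p.2] with x h1 h2 h3 h4
  rw [cornerFun, ← sign_mul_indicator_uIcc h1 h2, ← sign_mul_indicator_uIcc h3 h4,
    indicator_cornerRect]
  ring

/-- The signs square to 1 off the axes. If p is on an axis they vanish, but so does the indicator
almost everywhere, since the corner rectangle is degenerate. -/
lemma sign_mul_cornerFun_ae_eq (D : Set (ℝ × ℝ)) (p : ℝ × ℝ) :
    (fun x => Real.sign p.1 * Real.sign p.2 * cornerFun D p x)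
      =ᵐ[volume] (cornerRect D p).indicator (fun _ => 1) := by
  have key : ∀ s y : ℝ, y ≠ 0 → Real.sign s * Real.sign s * (uIcc 0 s).indicator (fun _ => 1) y =
      (uIcc 0 s).indicator (fun _ => (1 : ℝ)) y := by
    intro s y hy
    by_cases hs : s = 0
    · subst hs; simp [hy]
    · rcases Real.sign_apply_eq_of_ne_zero s hs with h | h <;> simp [h]
  filter_upwards [ae_fst_ne 0, ae_snd_ne 0, sign_mul_indicator_cornerRect_ae_eq D p]
    with x h1 h2 h3
  rw [← h3, indicator_cornerRect]
  conv_rhs => rw [← key p.1 x.1 h1, ← key p.2 x.2 h2]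
  ring

lemma rectIncr_cornerFun (D : Set (ℝ × ℝ)) {s₁ s₂ t₁ t₂ : ℝ} (hs : s₁ ≤ s₂) (ht : t₁ ≤ t₂)
    (x : ℝ × ℝ) : rectIncr (fun p => cornerFun D p x) s₁ s₂ t₁ t₂ =
      ((Ioc s₁ s₂ ×ˢ Ioc t₁ t₂) ∩ D).indicator (fun _ => 1) x := by
  have h : rectIncr (fun p => cornerFun D p x) s₁ s₂ t₁ t₂ =
      (stepFun s₂ x.1 - stepFun s₁ x.1) * (stepFun t₂ x.2 - stepFun t₁ x.2) *
        D.indicator (fun _ => 1) x := by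
    simp only [rectIncr, cornerFun]; ring
  rw [h, stepFun_sub hs, stepFun_sub ht]
  by_cases h1 : x.1 ∈ Ioc s₁ s₂ <;> by_cases h2 : x.2 ∈ Ioc t₁ t₂ <;> by_cases h3 : x ∈ D <;>
    simp [indicator, h1, h2, h3]

/-! ### Increments and L² continuity of the signed process -/

namespace HasCovMeasure

variable {Ω : Type*} [MeasurableSpace Ω] {P : Measure Ω} {Y : PlaneTest → Ω → ℝ}
  {D : Set (ℝ × ℝ)} {m : Measure ((ℝ × ℝ) × (ℝ × ℝ))} {W : ℝ × ℝ → Ω → ℝ}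

lemma isWienerIntegral_const_mul (hY : HasCovMeasure P Y D m) {g : ℝ × ℝ → ℝ} {ξ : Ω → ℝ}
    (hξ : IsWienerIntegral P Y D g ξ) (a : ℝ) :
    IsWienerIntegral P Y D (fun p => a * g p) (fun ω => a * ξ ω) := by
  simpa using hY.isWienerIntegral_linearCombination hξ hξ a 0

lemma isWienerIntegral_rectIncr (hY : HasCovMeasure P Y D m)
    (hW : ∀ p, IsWienerIntegral P Y D (cornerFun D p) (W p)) {s₁ s₂ t₁ t₂ : ℝ} (hs : s₁ ≤ s₂)
    (ht : t₁ ≤ t₂) : IsWienerIntegral P Y D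
      (((Ioc s₁ s₂ ×ˢ Ioc t₁ t₂) ∩ D).indicator fun _ => 1)
      (fun ω => rectIncr (fun p => W p ω) s₁ s₂ t₁ t₂) := by
  have h1 := hY.isWienerIntegral_linearCombination (hW (s₂, t₂)) (hW (s₂, t₁)) 1 (-1)
  have h2 := hY.isWienerIntegral_linearCombination h1 (hW (s₁, t₂)) 1 (-1)
  have h3 := hY.isWienerIntegral_linearCombination h2 (hW (s₁, t₁)) 1 1
  convert h3 using 1
  · funext x
    rw [← rectIncr_cornerFun D hs ht x, rectIncr]; ring
  · funext ω
    rw [rectIncr]; ring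

lemma ofReal_integral_indicator (hY : HasCovMeasure P Y D m) {A : Set (ℝ × ℝ)}
    (hA : MeasurableSet A) : ENNReal.ofReal (∫ z, A.indicator (fun _ => (1 : ℝ)) z.1 *
      A.indicator (fun _ => 1) z.2 ∂m) = m (A ×ˢ A) := by
  have := hY.finite
  have h : (fun z : (ℝ × ℝ) × (ℝ × ℝ) => A.indicator (fun _ => (1 : ℝ)) z.1 *
      A.indicator (fun _ => 1) z.2) = (A ×ˢ A).indicator fun _ => 1 := by
    funext z
    by_cases h1 : z.1 ∈ A <;> by_cases h2 : z.2 ∈ A <;> simp [indicator, h1, h2]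
  rw [h, integral_indicator_const _ (hA.prod hA), smul_eq_mul, mul_one, ofReal_measureReal]

lemma lintegral_rectIncr_pow_le (hY : HasCovMeasure P Y D m) (hD : MeasurableSet D)
    (hW : ∀ p, IsWienerIntegral P Y D (cornerFun D p) (W p)) {s₁ s₂ t₁ t₂ : ℝ} (hs : s₁ ≤ s₂)
    (ht : t₁ ≤ t₂) (k : ℕ) :
    ∫⁻ ω, ‖rectIncr (fun p => W p ω) s₁ s₂ t₁ t₂‖ₑ ^ (2 * k) ∂P ≤ gaussMoment k *
      m ((Icc s₁ s₂ ×ˢ Icc t₁ t₂) ×ˢ (Icc s₁ s₂ ×ˢ Icc t₁ t₂)) ^ k := by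
  refine (hY.lintegral_enorm_pow_le (hY.isWienerIntegral_rectIncr hW hs ht) k).trans ?_
  rw [hY.ofReal_integral_indicator ((measurableSet_Ioc.prod measurableSet_Ioc).inter hD)]
  have hsub : (Ioc s₁ s₂ ×ˢ Ioc t₁ t₂) ∩ D ⊆ Icc s₁ s₂ ×ˢ Icc t₁ t₂ :=
    inter_subset_left.trans (prod_mono Ioc_subset_Icc_self Ioc_subset_Icc_self)
  gcongr

lemma ae_rectIncr_eq_zero (hY : HasCovMeasure P Y D m)
    (hW : ∀ p, IsWienerIntegral P Y D (cornerFun D p) (W p)) {s₁ s₂ t₁ t₂ : ℝ} (hs : s₁ ≤ s₂)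
    (ht : t₁ ≤ t₂) (hdisj : (Ioc s₁ s₂ ×ˢ Ioc t₁ t₂) ∩ D = ∅) :
    ∀ᵐ ω ∂P, rectIncr (fun p => W p ω) s₁ s₂ t₁ t₂ = 0 :=
  hY.ae_eq_zero_of_isWienerIntegral (hY.isWienerIntegral_rectIncr hW hs ht) (by simp [hdisj])

/-- Continuity in probability of the process along dyadic approximations. -/
lemma tendstoInMeasure_dyadicFloor (hY : HasCovMeasure P Y D m) (hD : MeasurableSet D)
    (hW : ∀ p, IsWienerIntegral P Y D (cornerFun D p) (W p)) (p : ℝ × ℝ) :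
    TendstoInMeasure P (fun n => W (dyadicFloor n p.1, dyadicFloor n p.2)) atTop (W p) := by
  refine tendstoInMeasure_of_tendsto_eLpNorm two_ne_zero (fun n => (hW _).memLp.1)
    (hW p).memLp.1 ?_
  set q : ℕ → ℝ × ℝ := fun n => (dyadicFloor n p.1, dyadicFloor n p.2) with hq
  have hmom : ∀ n, ∫⁻ ω, ‖W (q n) ω - W p ω‖ₑ ^ (2 * 1) ∂P ≤ gaussMoment 1 *
      ENNReal.ofReal (∫ z, (cornerFun D (q n) z.1 - cornerFun D p z.1) *
        (cornerFun D (q n) z.2 - cornerFun D p z.2) ∂m) ^ 1 := by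
    intro n
    have h := hY.lintegral_enorm_pow_le
      (hY.isWienerIntegral_linearCombination (hW (q n)) (hW p) 1 (-1)) 1
    simpa only [one_mul, neg_mul, ← sub_eq_add_neg] using h
  have hinteg := hY.tendsto_integral_mul (l := atTop)
    (f := fun n x => cornerFun D (q n) x - cornerFun D p x) (g := fun _ => 0) (M := 1 + 1)
    (fun n => (measurable_cornerFun hD _).sub (measurable_cornerFun hD _))
    (fun n x => (abs_sub _ _).trans (add_le_add (abs_cornerFun_le _ _ _) (abs_cornerFun_le _ _ _)))
    (by
      filter_upwards [ae_fst_ne p.1, ae_snd_ne p.2] with x h1 h2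
      have h := (((tendsto_stepFun_dyadicFloor h1).mul (tendsto_stepFun_dyadicFloor h2)).mul_const
        (D.indicator (fun _ => (1 : ℝ)) x)).sub_const (cornerFun D p x)
      simpa [cornerFun] using h)
  have hlim : Tendsto (fun n => ∫⁻ ω, ‖W (q n) ω - W p ω‖ₑ ^ (2 * 1) ∂P) atTop (𝓝 0) := by
    refine tendsto_of_tendsto_of_tendsto_of_le_of_le tendsto_const_nhds ?_ (fun _ => zero_le) hmom
    have h := ENNReal.Tendsto.const_mul (a := gaussMoment 1) (ENNReal.tendsto_ofReal hinteg)
      (Or.inr (gaussMoment_lt_top 1).ne)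
    simpa using h
  have h2 := hlim.ennrpow_const (1 / 2 : ℝ)
  rw [ENNReal.zero_rpow_of_pos (by norm_num)] at h2
  refine h2.congr fun n => ?_
  rw [eLpNorm_eq_lintegral_rpow_enorm_toReal two_ne_zero (by norm_num)]
  simp [hq]

/-- The pathwise limit and the limit in probability along the same dyadic points must agree. -/
lemma ae_dyadicLim_eq (hY : HasCovMeasure P Y D m) (hD : MeasurableSet D)
    (hW : ∀ p, IsWienerIntegral P Y D (cornerFun D p) (W p)) (p : ℝ × ℝ)
    (hlim : ∀ᵐ ω ∂P, Tendsto (fun n => W (dyadicFloor n p.1, dyadicFloor n p.2) ω) atTop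
      (𝓝 (dyadicLim (fun p => W p ω) p))) :
    (fun ω => dyadicLim (fun p => W p ω) p) =ᵐ[P] W p := by
  obtain ⟨ns, hns, hae⟩ := (hY.tendstoInMeasure_dyadicFloor hD hW p).exists_seq_tendsto_ae
  filter_upwards [hlim, hae] with ω h1 h2
  exact tendsto_nhds_unique (h1.comp hns.tendsto_atTop) h2

end HasCovMeasure

/-- Almost surely, the process of corner rectangles satisfies dyadic bounds of all orders
below a pair of exponents `γ, γ'`. -/
lemma ae_exists_dyadicCellBound_corner {Ω : Type*} [MeasurableSpace Ω] {P : Measure Ω}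
    {Y : PlaneTest → Ω → ℝ} {D : Set (ℝ × ℝ)} {H ν γ γ' η η' : ℝ} {W : ℝ × ℝ → Ω → ℝ}
    (hY : HasCovMeasure P Y D (noiseMeasure H ν D)) (hD : IsCompact D)
    (hW : ∀ p, IsWienerIntegral P Y D (cornerFun D p) (W p)) (hH : H ∈ Ioo (1 / 2 : ℝ) 1)
    (hν : ν ∈ Ioo (0 : ℝ) 1) (hγ : γ ∈ Ioo (1 / 2 : ℝ) 1) (hγ' : γ' ∈ Ioo (1 / 2 : ℝ) 1)
    (hsum : γ + γ' = H + (2 - ν) / 2) (hη : η < γ) (hη' : η' < γ') :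
    ∀ᵐ ω ∂P, ∃ K, 0 ≤ K ∧ DyadicCellBound η η' K (fun p => W p ω) := by
  obtain ⟨C, hC0, hC⟩ := exists_noiseMeasure_rect_le hH hν hγ hγ' hsum D
  obtain ⟨M, hM⟩ := hD.isBounded.exists_norm_le
  obtain ⟨N, hN⟩ := exists_nat_gt M
  -- The moment order has to absorb both exponent gaps, while N exceeds the norm bound of the domain
  -- so that cells outside [-N,N]² miss it.
  obtain ⟨k, hk⟩ := exists_nat_ge (max (1 / (γ - η)) (1 / (γ' - η')))
  have hk1 : 1 ≤ k * (γ - η) := (div_le_iff₀ (sub_pos.2 hη)).1 ((le_max_left _ _).trans hk)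
  have hk2 : 1 ≤ k * (γ' - η') := (div_le_iff₀ (sub_pos.2 hη')).1 ((le_max_right _ _).trans hk)
  have hk0 : k ≠ 0 := by
    rintro rfl
    norm_num at hk1
  refine ae_exists_dyadicCellBound (γ := γ) (γ' := γ') (k := k) (N := N)
    (C := gaussMoment k * ENNReal.ofReal C ^ k) (fun p => (hW p).memLp.1.aemeasurable)
    (ENNReal.mul_lt_top (gaussMoment_lt_top k) (by simp)) hk0 (by linarith) (by linarith) ?_ ?_
  · intro s₁ s₂ t₁ t₂ hs ht
    refine (hY.lintegral_rectIncr_pow_le hD.measurableSet hW hs ht k).trans ?_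
    rw [mul_assoc, ← mul_pow, ← ENNReal.ofReal_mul hC0]
    gcongr
    exact hC _ _ _ _ hs ht
  · intro s₁ s₂ t₁ t₂ hs ht hcase
    refine hY.ae_rectIncr_eq_zero hW hs ht ?_
    rw [eq_empty_iff_forall_notMem]
    rintro x ⟨⟨hx1, hx2⟩, hxD⟩
    have h1 := abs_le.1 ((norm_fst_le x).trans (hM x hxD))
    have h2 := abs_le.1 ((norm_snd_le x).trans (hM x hxD))
    rcases hcase with h | h | h | h <;>
      linarith [h1.1, h1.2, h2.1, h2.2, hx1.1, hx1.2, hx2.1, hx2.2]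

end FracNoise

end

open FracNoise in
theorem lemma3p4 {Ω : Type*} [MeasurableSpace Ω] (P : Measure Ω) [IsProbabilityMeasure P]
    (H ν T R₁ R₂ : ℝ) (hH : H ∈ Ioo (1 / 2 : ℝ) 1) (hν : ν ∈ Ioo (0 : ℝ) 1) (hT : 0 < T)
    (hR : R₁ < R₂) (X : FracNoise.PlaneTest → Ω → ℝ)
    (hX : FracNoise.IsFractionalNoise P H ν T X) :
    -- the process `x` is well defined, up to almost sure equality at each point of the domain
    (∀ p ∈ FracNoise.domain R₁ R₂ T, ∃ ξ : Ω → ℝ,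
      FracNoise.IsRotatedNoiseOfSet P X (FracNoise.domain R₁ R₂ T)
        (FracNoise.cornerRect (FracNoise.domain R₁ R₂ T) p) ξ) ∧
    -- and it has a modification `y` whose paths have the asserted regularity
    ∀ x : ℝ × ℝ → Ω → ℝ,
      (∀ p ∈ FracNoise.domain R₁ R₂ T,
        FracNoise.IsRotatedNoiseOfSet P X (FracNoise.domain R₁ R₂ T)
          (FracNoise.cornerRect (FracNoise.domain R₁ R₂ T) p) (x p)) →
      ∃ y : ℝ × ℝ → Ω → ℝ,
        (∀ p ∈ FracNoise.domain R₁ R₂ T, y p =ᵐ[P] x p) ∧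
        ∀ᵐ ω ∂P, ∀ γ γ' : ℝ, γ ∈ Ioo (1 / 2 : ℝ) 1 → γ' ∈ Ioo (1 / 2 : ℝ) 1 →
          γ + γ' = H + (2 - ν) / 2 →
          ∀ η ∈ Ioo 0 γ, ∀ η' ∈ Ioo 0 γ',
            FracNoise.MemRectHolder (FracNoise.domain R₁ R₂ T) η η' (fun p => y p ω) := by
  have hY := hasCovMeasure_rotatedNoise R₁ R₂ hH hν hX
  have hDc : IsCompact (domain R₁ R₂ T) := isCompact_domain R₁ R₂ T
  have hex : ∀ p, ∃ ξ, IsRotatedNoiseOfSet P X (domain R₁ R₂ T)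
      (cornerRect (domain R₁ R₂ T) p) ξ := fun p =>
    hY.exists_isRotatedNoiseOfSet
      (exists_isApproximating_cornerRect hDc (convex_domain R₁ R₂ T) p)
  refine ⟨fun p _ => hex p, fun x hx => ?_⟩
  choose ξ hξ using hex
  -- The auxiliary `ξ` is chosen at every point of the plane: x is prescribed only on the domain,
  -- while dyadic cells and axes may leave it.
  set W : ℝ × ℝ → Ω → ℝ := fun p ω => Real.sign p.1 * Real.sign p.2 * ξ p ω with hWdef
  have hW : ∀ p, IsWienerIntegral P (rotatedNoise X) (domain R₁ R₂ T)
      (cornerFun (domain R₁ R₂ T) p) (W p) := fun p =>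
    (hY.isWienerIntegral_const_mul (hξ p).isWienerIntegral _).congr
      (sign_mul_indicator_cornerRect_ae_eq _ p)
  have h0 : ∀ ω t, W (0, t) ω = 0 := fun ω t => by simp [hWdef]
  have h0' : ∀ ω s, W (s, 0) ω = 0 := fun ω s => by simp [hWdef]
  -- Countably many rational exponents give a single exceptional null set; any η, η' below γ, γ' lie
  -- under such a pair.
  have hbound : ∀ᵐ ω ∂P, ∀ a b : ℚ, (∃ γ γ' : ℝ, γ ∈ Ioo (1 / 2 : ℝ) 1 ∧ γ' ∈ Ioo (1 / 2 : ℝ) 1 ∧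
      γ + γ' = H + (2 - ν) / 2 ∧ a < γ ∧ b < γ') →
      ∃ K, 0 ≤ K ∧ DyadicCellBound a b K (fun p => W p ω) := by
    rw [ae_all_iff]; intro a
    rw [ae_all_iff]; intro b
    by_cases h : ∃ γ γ' : ℝ, γ ∈ Ioo (1 / 2 : ℝ) 1 ∧ γ' ∈ Ioo (1 / 2 : ℝ) 1 ∧
      γ + γ' = H + (2 - ν) / 2 ∧ a < γ ∧ b < γ'
    · obtain ⟨γ, γ', hγ, hγ', hsum, ha, hb⟩ := h
      filter_upwards [ae_exists_dyadicCellBound_corner hY hDc hW hH hν hγ hγ' hsum ha hb]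
        with ω hω _ using hω
    · exact Eventually.of_forall fun ω h' => absurd h' h
  have hholder : ∀ᵐ ω ∂P, ∀ γ γ' : ℝ, γ ∈ Ioo (1 / 2 : ℝ) 1 → γ' ∈ Ioo (1 / 2 : ℝ) 1 →
      γ + γ' = H + (2 - ν) / 2 → ∀ η ∈ Ioo 0 γ, ∀ η' ∈ Ioo 0 γ',
        RectHolderOn dyadics η η' (fun p => W p ω) := by
    filter_upwards [hbound] with ω hω γ γ' hγ hγ' hsum η hη η' hη'
    obtain ⟨a, ha1, ha2⟩ := exists_rat_btwn hη.2
    obtain ⟨b, hb1, hb2⟩ := exists_rat_btwn hη'.2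
    obtain ⟨K, hK0, hK⟩ := hω a b ⟨γ, γ', hγ, hγ', hsum, ha2, hb2⟩
    exact (hK.mono hK0 ha1.le hb1.le).rectHolderOn hη.1 hη'.1 hK0
  refine ⟨fun p ω => signTwist (dyadicLim fun q => W q ω) p, fun p hp => ?_, ?_⟩
  · have hlim : ∀ᵐ ω ∂P, Tendsto (fun n => W (dyadicFloor n p.1, dyadicFloor n p.2) ω) atTop
        (𝓝 (dyadicLim (fun p => W p ω) p)) := by
      filter_upwards [hholder] with ω hω
      -- Convergence requires only one admissible choice: γ = γ' equal to half the prescribed sum,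
      -- and both Hölder exponents 1/2.
      have hmem : (H + (2 - ν) / 2) / 2 ∈ Ioo (1 / 2 : ℝ) 1 :=
        ⟨by linarith [hH.1, hν.2], by linarith [hH.2, hν.1]⟩
      have hhalf : (1 / 2 : ℝ) ∈ Ioo 0 ((H + (2 - ν) / 2) / 2) := ⟨by norm_num, hmem.1⟩
      exact (hω _ _ hmem hmem (by ring) _ hhalf _ hhalf).tendsto_dyadicLim (by norm_num)
        (by norm_num) (h0 ω) (h0' ω) p
    have h1 := hY.ae_dyadicLim_eq hDc.measurableSet hW p hlim
    -- Undoing the signs on W yields another integral of the same indicator as x(p), so uniqueness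
    -- identifies the two.
    have h2 := hY.ae_eq_of_isWienerIntegral
      ((hY.isWienerIntegral_const_mul (hW p) (Real.sign p.1 * Real.sign p.2)).congr
        (sign_mul_cornerFun_ae_eq _ p)) (hx p hp).isWienerIntegral
    filter_upwards [h1, h2] with ω hω1 hω2
    rw [← hω2, signTwist, hω1]
  · filter_upwards [hholder] with ω hω γ γ' hγ hγ' hsum η hη η' hη'
    have hF := (hω γ γ' hγ hγ' hsum η hη η' hη').dyadicLim hη.1 hη'.1 (h0 ω) (h0' ω)
    have hF0 := dyadicLim_zero_left (f := fun q => W q ω) (h0 ω)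
    have hF0' := dyadicLim_zero_right (f := fun q => W q ω) (h0' ω)
    exact (hF.signTwist hη.1 hη'.1 hF0 hF0').memRectHolder hη.1 hη'.1
      (fun t => by simp [signTwist]) (fun s => by simp [signTwist]) hDc.isBounded
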